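/- Let $G$ be a finite non-abelian group, and let $\Gamma'_G$ be its non-commuting graph: the simple graph with vertex set $G\setminus Z(G)$ in which two vertices $x,y$ are adjacent if and only if $xy\neq yx$. Then $\Gamma'_G$ is not toroidal, that is, it does not have genus exactly $1$: it is not the case that $\Gamma'_G$ can be embedded in the torus but not in the sphere. (An embedding of a finite simple graph in a surface sends the vertices to distinct points and every edge to a simple arc joining the images of its ends, such that no arc passes through the image of a vertex in its interior and the arcs of two distinct edges have no interior point in common.) -/

import Mathlib

/-- The non-commuting graph of a group `G`: its vertices are the non-central elements of `G`, and
two vertices are adjacent when they do not commute. -/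
def nonCommutingGraph (G : Type*) [Group G] :
    SimpleGraph {g : G // g ∉ Subgroup.center G} where
  Adj x y := x.1 * y.1 ≠ y.1 * x.1
  symm := ⟨fun _ _ h => h.symm⟩
  loopless := ⟨fun _ h => h rfl⟩

/-- An embedding (drawing without crossings) of a finite simple graph `Γ` in a space `X`: the
vertices are sent to distinct points of `X`, and every edge to a simple arc joining the images of
its two ends, such that no arc passes through a vertex in its interior and the arcs of two
different edges have no interior point in common. -/
structure GraphEmbedding {V : Type*} (Γ : SimpleGraph V) (X : Type*) [TopologicalSpace X] where
  /-- the point representing a vertex -/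
  point : V → X
  /-- the arc representing an edge -/
  arc : Γ.edgeSet → C(unitInterval, X)
  point_injective : Function.Injective point
  arc_injective : ∀ e, Function.Injective (arc e)
  /-- The unordered pair of ends of the arc is the image of the unordered pair of ends of the
  edge. -/
  arc_ends : ∀ e : Γ.edgeSet, s(arc e 0, arc e 1) = Sym2.map point e.1
  arc_avoids_points : ∀ e, ∀ t ∈ Set.Ioo (0 : unitInterval) 1, ∀ v, arc e t ≠ point v
  arc_interiors_disjoint : ∀ e e', e ≠ e' →
    ∀ s ∈ Set.Ioo (0 : unitInterval) 1, ∀ t ∈ Set.Ioo (0 : unitInterval) 1, arc e s ≠ arc e' t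

/-- `Γ` can be embedded in the space `X`. -/
def EmbedsIn {V : Type*} (Γ : SimpleGraph V) (X : Type*) [TopologicalSpace X] : Prop :=
  Nonempty (GraphEmbedding Γ X)

/-- The sphere, the closed orientable surface of genus `0`. -/
abbrev SphereSurface : Type := Metric.sphere (0 : EuclideanSpace ℝ (Fin 3)) 1

/-- The torus `ℝ/ℤ × ℝ/ℤ`, the closed orientable surface of genus `1`. -/
abbrev TorusSurface : Type := UnitAddCircle × UnitAddCircle

/-- A finite graph is toroidal if its genus is `1`: it can be embedded in the torus, but not in the
sphere. -/
def IsToroidal {V : Type*} (Γ : SimpleGraph V) : Prop :=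
  EmbedsIn Γ TorusSurface ∧ ¬ EmbedsIn Γ SphereSurface

/-! If `G` has order at least 9, its graph contains `K₄,₅`, which does not embed in the torus;
otherwise the order is 6 or 8 and the graph is planar.

`K₄,₅` is excluded by algebra, without Euler's formula (`not_embedsIn_torus`). Like a theta
function, `torusSigma` vanishes only on the lattice and picks up an exponential factor under lattice
translations. If `α`, `β` lift disjoint edges, `torusSigma (β t - α s)` has no zero, so its
logarithm has no total change around the unit square (`sigmaIncr_reciprocity`). Modulo 2 this
expresses the intersection form of the lattice displacements of the two edges through integers
attached to edge-vertex pairs (`CrossingRelations`). Summation eliminates these integers: every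
`K₃,₃` yields van Kampen's odd constant, and disjoint four-cycles have intersection number zero. A
finite check finds no classes in `𝔽₂²` satisfying both.

To find `K₄,₅` in a group of order `n`, `exists_pairs` supplies four elements with only two
centralizers, of orders `s` and `t`. Elements outside both are joined to all four, and there are at
least `(n - s) * (n - t) / n` of them. This exceeds 4 if `n ≥ 17`, or if `n ≥ 10` and both indices
are at least 3. Otherwise some centralizer of index two is abelian, and its non-central elements are
joined to everything outside it. -/

/-! ### Continuous logarithms and their increments along paths -/

open Complex in
/-- The normalised exponential `z ↦ exp (2πiz)`, of period `1`. -/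
noncomputable def expUnit (z : ℂ) : ℂ := Complex.exp (2 * Real.pi * I * z)

lemma expUnit_add (z w : ℂ) : expUnit (z + w) = expUnit z * expUnit w := by
  rw [expUnit, mul_add, Complex.exp_add]; rfl

lemma expUnit_ne_zero (z : ℂ) : expUnit z ≠ 0 := Complex.exp_ne_zero _

lemma expUnit_zero : expUnit 0 = 1 := by simp [expUnit]

@[fun_prop]
lemma continuous_expUnit : Continuous expUnit := by unfold expUnit; fun_prop

lemma expUnit_half : expUnit (1 / 2) = -1 := by
  rw [expUnit, ← Complex.exp_pi_mul_I]; congr 1; ring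

lemma expUnit_eq_one_iff {z : ℂ} : expUnit z = 1 ↔ ∃ n : ℤ, z = n := by
  rw [expUnit, Complex.exp_eq_one_iff]
  refine exists_congr fun n => ?_
  rw [mul_comm, mul_left_inj' Complex.two_pi_I_ne_zero]

lemma expUnit_eq_expUnit_iff {z w : ℂ} : expUnit z = expUnit w ↔ ∃ n : ℤ, z = w + n := by
  have h : expUnit z = expUnit (z - w) * expUnit w := by rw [← expUnit_add, sub_add_cancel]
  rw [h, mul_eq_right₀ (expUnit_ne_zero w), expUnit_eq_one_iff]
  exact exists_congr fun n => by rw [sub_eq_iff_eq_add']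

lemma exists_expUnit_eq {z : ℂ} (hz : z ≠ 0) : ∃ w, expUnit w = z := by
  refine ⟨Complex.log z / (2 * Real.pi * Complex.I), ?_⟩
  rw [expUnit, mul_div_cancel₀ _ Complex.two_pi_I_ne_zero, Complex.exp_log hz]

lemma norm_expUnit_ofReal (x : ℝ) : ‖expUnit x‖ = 1 := by
  rw [expUnit, show (2 * Real.pi * Complex.I * x : ℂ) = ((2 * Real.pi * x : ℝ) : ℂ) * Complex.I by
    push_cast; ring]
  exact Complex.norm_exp_ofReal_mul_I _

/-- A nowhere vanishing continuous function on a simply connected space has a continuous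
logarithm. -/
lemma exists_continuous_expUnit_eq {A : Type*} [TopologicalSpace A] [SimplyConnectedSpace A]
    [LocallyPathConnectedSpace A] {F : A → ℂ} (hF : Continuous F) (h0 : ∀ a, F a ≠ 0) :
    ∃ L : A → ℂ, Continuous L ∧ ∀ a, expUnit (L a) = F a := by
  obtain ⟨a₀⟩ : Nonempty A := inferInstance
  obtain ⟨L, ⟨-, hL⟩, -⟩ := Complex.isCoveringMapOn_exp.existsUnique_continuousMap_lifts
    ⟨F, hF⟩ (a₀ := a₀) (e₀ := Complex.log (F a₀)) (Complex.exp_log (h0 a₀)) h0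
  refine ⟨fun a => L a / (2 * Real.pi * Complex.I), by fun_prop, fun a => ?_⟩
  rw [expUnit, mul_div_cancel₀ _ Complex.two_pi_I_ne_zero]
  exact congrFun hL a

/-- Two continuous logarithms of the same function differ by a constant. -/
lemma sub_eq_sub_of_expUnit_eq {A : Type*} [TopologicalSpace A] [PreconnectedSpace A]
    {L M : A → ℂ} (hL : Continuous L) (hM : Continuous M)
    (h : ∀ a, expUnit (L a) = expUnit (M a)) (a b : A) : L a - L b = M a - M b := by
  choose n hn using fun a => expUnit_eq_expUnit_iff.1 (h a)
  have hc : Continuous n := by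
    have : Continuous fun a => ((n a : ℤ) : ℂ) := by
      have : (fun a => ((n a : ℤ) : ℂ)) = fun a => L a - M a := by
        funext a; rw [hn a]; ring
      rw [this]; exact hL.sub hM
    have h2 : Continuous fun a => ((n a : ℤ) : ℝ) := by
      simpa [Function.comp_def] using Complex.continuous_re.comp this
    exact Int.isClosedEmbedding_coe_real.isInducing.continuous_iff.2 h2
  have := PreconnectedSpace.constant inferInstance hc (x := a) (y := b)
  rw [hn a, hn b, this]; ring

/-- `HasLogIncr F c`: the total change over `[0, 1]` of a continuous logarithm of `F` is `c`. -/
def HasLogIncr (F : ℝ → ℂ) (c : ℂ) : Prop :=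
  ∃ L : ℝ → ℂ, Continuous L ∧ (∀ t, expUnit (L t) = F t) ∧ L 1 - L 0 = c

/-- The total change over `[0, 1]` of a continuous logarithm of `F`. -/
noncomputable def logIncr (F : ℝ → ℂ) : ℂ := Classical.epsilon (HasLogIncr F)

lemma HasLogIncr.unique {F : ℝ → ℂ} {c d : ℂ} (hc : HasLogIncr F c) (hd : HasLogIncr F d) :
    c = d := by
  obtain ⟨L, hL, hLF, rfl⟩ := hc
  obtain ⟨M, hM, hMF, rfl⟩ := hd
  exact sub_eq_sub_of_expUnit_eq hL hM (fun a => (hLF a).trans (hMF a).symm) 1 0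

lemma HasLogIncr.logIncr_eq {F : ℝ → ℂ} {c : ℂ} (hc : HasLogIncr F c) : logIncr F = c :=
  (Classical.epsilon_spec (p := HasLogIncr F) ⟨c, hc⟩).unique hc

lemma hasLogIncr_logIncr {F : ℝ → ℂ} (hF : Continuous F) (h0 : ∀ t, F t ≠ 0) :
    HasLogIncr F (logIncr F) := by
  obtain ⟨L, hL, hLF⟩ := exists_continuous_expUnit_eq hF h0
  exact Classical.epsilon_spec (p := HasLogIncr F) ⟨_, L, hL, hLF, rfl⟩

lemma HasLogIncr.expUnit_mul {F : ℝ → ℂ} {c : ℂ} (hc : HasLogIncr F c) :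
    expUnit c * F 0 = F 1 := by
  obtain ⟨L, -, hLF, rfl⟩ := hc
  rw [← hLF, ← hLF, ← expUnit_add, sub_add_cancel]

lemma HasLogIncr.mul {F G : ℝ → ℂ} {c d : ℂ} (hc : HasLogIncr F c) (hd : HasLogIncr G d) :
    HasLogIncr (fun t => F t * G t) (c + d) := by
  obtain ⟨L, hL, hLF, rfl⟩ := hc
  obtain ⟨M, hM, hMF, rfl⟩ := hd
  exact ⟨fun t => L t + M t, hL.add hM, fun t => by rw [expUnit_add, hLF, hMF], by ring⟩

lemma hasLogIncr_expUnit {h : ℝ → ℂ} (hh : Continuous h) :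
    HasLogIncr (fun t => expUnit (h t)) (h 1 - h 0) := ⟨h, hh, fun _ => rfl, rfl⟩

/-- The boundary of a square has total logarithmic change zero. -/
lemma logIncr_square {F : ℝ → ℝ → ℂ} (hF : Continuous (Function.uncurry F))
    (h0 : ∀ s t, F s t ≠ 0) :
    logIncr (F 1) - logIncr (F 0) = logIncr (fun s => F s 1) - logIncr (fun s => F s 0) := by
  -- The plane is simply connected, so a single logarithm serves all four sides.
  obtain ⟨L, hL, hLF⟩ := exists_continuous_expUnit_eq hF fun a => h0 a.1 a.2
  have h1 : ∀ s, logIncr (F s) = L (s, 1) - L (s, 0) := fun s =>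
    HasLogIncr.logIncr_eq ⟨fun t => L (s, t), by fun_prop, fun t => hLF (s, t), rfl⟩
  have h2 : ∀ t, logIncr (fun s => F s t) = L (1, t) - L (0, t) := fun t =>
    HasLogIncr.logIncr_eq ⟨fun s => L (s, t), by fun_prop, fun s => hLF (s, t), rfl⟩
  rw [h1, h1, h2, h2]; ring

/-! ### A quasi-periodic function vanishing only on the lattice -/

/-- A continuous section, with a single zero, of a line bundle of degree one on the torus. -/
noncomputable def torusSection (x y : ℝ) : ℂ :=
  (1 - Int.fract y : ℝ) * expUnit (-x * Int.fract y : ℝ) +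
    (Int.fract y : ℝ) * expUnit (x * (1 - Int.fract y) : ℝ)

/-- The jumps of the fractional part are harmless: the formula takes the value 1 at both `r = 0` and
`r = 1`. -/
lemma continuous_torusSection : Continuous (Function.uncurry torusSection) := by
  let f : ℝ × ℝ → ℝ → ℂ := fun p r =>
    (1 - r : ℝ) * expUnit (-p.1 * r : ℝ) + (r : ℝ) * expUnit (p.1 * (1 - r) : ℝ)
  have hf : Continuous (Function.uncurry f) := by
    simp only [f, Function.uncurry_def]; fun_prop
  have := ContinuousOn.comp_fract (s := fun p : ℝ × ℝ => p.2) hf.continuousOn continuous_snd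
    (fun p => by simp [f, expUnit_zero])
  exact this

lemma torusSection_add_intCast_right (x y : ℝ) (m : ℤ) :
    torusSection x (y + m) = torusSection x y := by
  simp [torusSection]

lemma torusSection_add_intCast_left (x y : ℝ) (m : ℤ) :
    torusSection (x + m) y = expUnit (-m * y : ℝ) * torusSection x y := by
  have h1 : expUnit (-(x + m) * Int.fract y : ℝ) =
      expUnit (-m * y : ℝ) * expUnit (-x * Int.fract y : ℝ) := by
    rw [← expUnit_add, expUnit_eq_expUnit_iff]
    refine ⟨m * ⌊y⌋, ?_⟩
    rw [Int.fract]; push_cast; ring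
  have h2 : expUnit ((x + m) * (1 - Int.fract y) : ℝ) =
      expUnit (-m * y : ℝ) * expUnit (x * (1 - Int.fract y) : ℝ) := by
    rw [← expUnit_add, expUnit_eq_expUnit_iff]
    refine ⟨m * ⌊y⌋ + m, ?_⟩
    rw [Int.fract]; push_cast; ring
  rw [torusSection, h1, h2, torusSection]; ring

lemma torusSection_neg (x y : ℝ) : torusSection (-x) (-y) = torusSection x y := by
  by_cases h : Int.fract y = 0
  · have h' : Int.fract (-y) = 0 := Int.fract_neg_eq_zero.2 h
    simp [torusSection, h, h', expUnit_zero]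
  · rw [torusSection, torusSection, Int.fract_neg h, add_comm]
    congr 3 <;> ring_nf

/-- Two unit numbers with weights `1 - Int.fract y` and `Int.fract y` cancel only if the weights are
equal and the phases opposite. -/
lemma torusSection_eq_zero {x y : ℝ} (h : torusSection x y = 0) :
    ∃ m n : ℤ, x = m + 1 / 2 ∧ y = n + 1 / 2 := by
  have h1 := eq_neg_of_add_eq_zero_left h
  have h2 := congrArg norm h1
  rw [norm_neg, norm_mul, norm_mul, norm_expUnit_ofReal, norm_expUnit_ofReal, mul_one, mul_one,
    Complex.norm_real, Complex.norm_real, Real.norm_of_nonneg (Int.fract_nonneg y),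
    Real.norm_of_nonneg (sub_nonneg.2 (Int.fract_lt_one y).le)] at h2
  have h3 : Int.fract y = 1 / 2 := by linarith
  rw [h3, show (1 - 1 / 2 : ℝ) = 1 / 2 by norm_num, ← mul_neg] at h1
  have h4 := mul_left_cancel₀ (by norm_num) h1
  rw [neg_eq_neg_one_mul (expUnit _), ← expUnit_half, ← expUnit_add, expUnit_eq_expUnit_iff] at h4
  obtain ⟨n, hn⟩ := h4
  refine ⟨-n - 1, ⌊y⌋, ?_, by rw [← h3, Int.floor_add_fract]⟩
  have hn' : (-x * (1 / 2) : ℝ) = 1 / 2 + x * (1 / 2) + n :=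
    Complex.ofReal_injective (by rw [hn]; push_cast; ring)
  push_cast; linarith

/-- The translate of `torusSection` whose zeros are the points with integral coordinates. -/
noncomputable def torusSigma (z : ℝ × ℝ) : ℂ := torusSection (z.1 + 1 / 2) (z.2 + 1 / 2)

@[fun_prop]
lemma continuous_torusSigma : Continuous torusSigma :=
  continuous_torusSection.comp (f := fun z : ℝ × ℝ => (z.1 + 1 / 2, z.2 + 1 / 2)) (by fun_prop)

/-- The translation of the plane by an integral vector. -/
def latticeVector (m : ℤ × ℤ) : ℝ × ℝ := (m.1, m.2)

lemma torusSigma_eq_zero {z : ℝ × ℝ} (h : torusSigma z = 0) : ∃ m, z = latticeVector m := by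
  obtain ⟨m, n, hm, hn⟩ := torusSection_eq_zero h
  exact ⟨(m, n), Prod.ext (add_right_cancel hm) (add_right_cancel hn)⟩

lemma torusSigma_add_latticeVector (z : ℝ × ℝ) (m : ℤ × ℤ) :
    torusSigma (z + latticeVector m) = expUnit (-m.1 * (z.2 + 1 / 2) : ℝ) * torusSigma z := by
  rw [torusSigma, torusSigma, ← torusSection_add_intCast_left,
    ← torusSection_add_intCast_right _ (z.2 + 1 / 2) m.2]
  simp only [latticeVector, Prod.fst_add, Prod.snd_add]
  congr 1 <;> ring

lemma torusSigma_neg (z : ℝ × ℝ) : torusSigma (-z) = expUnit (z.2 + 1 / 2 : ℝ) * torusSigma z := by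
  have h1 : torusSigma (-z) = torusSection (z.1 - 1 / 2) (z.2 - 1 / 2) := by
    rw [torusSigma, ← torusSection_neg]
    simp only [Prod.fst_neg, Prod.snd_neg]
    congr 1 <;> ring
  have h2 := torusSection_add_intCast_left (z.1 + 1 / 2) (z.2 + 1 / 2) (-1)
  have h3 := torusSection_add_intCast_right (z.1 - 1 / 2) (z.2 - 1 / 2) 1
  rw [h1, ← h3, torusSigma, show z.2 - 1 / 2 + ((1 : ℤ) : ℝ) = z.2 + 1 / 2 by push_cast; ring]
  convert h2 using 3 <;> push_cast <;> ring

/-- The total logarithmic change of `torusSigma` along a path, seen from a point. -/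
noncomputable def sigmaIncr (α : ℝ → ℝ × ℝ) (p : ℝ × ℝ) : ℂ :=
  logIncr fun t => torusSigma (α t - p)

lemma torusSigma_sub_ne_zero {x y : ℝ × ℝ} (h : ∀ m, x ≠ y + latticeVector m) :
    torusSigma (x - y) ≠ 0 := fun h0 => by
  obtain ⟨m, hm⟩ := torusSigma_eq_zero h0
  exact h m (by rw [← hm, add_sub_cancel])

lemma hasLogIncr_sigmaIncr {α : ℝ → ℝ × ℝ} {p : ℝ × ℝ} (hα : Continuous α)
    (h : ∀ t m, α t ≠ p + latticeVector m) :
    HasLogIncr (fun t => torusSigma (α t - p)) (sigmaIncr α p) :=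
  hasLogIncr_logIncr (by fun_prop) fun t => torusSigma_sub_ne_zero (h t)

/-- The quasi-period factor is an explicit exponential along the path and contributes the increment
of its exponent. -/
lemma sigmaIncr_add_latticeVector {α : ℝ → ℝ × ℝ} {p : ℝ × ℝ} (hα : Continuous α)
    (h : ∀ t m, α t ≠ p + latticeVector m) (m : ℤ × ℤ) :
    sigmaIncr α (p + latticeVector m) = sigmaIncr α p + m.1 * ((α 1).2 - (α 0).2 : ℝ) := by
  have h1 := (hasLogIncr_sigmaIncr hα h).mul
    (hasLogIncr_expUnit (h := fun t => (m.1 * ((α t - p).2 + 1 / 2) : ℝ)) (by fun_prop))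
  have h2 : (fun t => torusSigma (α t - p) * expUnit (m.1 * ((α t - p).2 + 1 / 2) : ℝ)) =
      fun t => torusSigma (α t - (p + latticeVector m)) := by
    funext t
    have : α t - (p + latticeVector m) = α t - p + latticeVector (-m) := by
      simp [latticeVector, Prod.ext_iff]; constructor <;> ring
    rw [this, torusSigma_add_latticeVector, mul_comm]
    simp
  rw [h2] at h1
  refine h1.logIncr_eq.trans ?_
  push_cast [Prod.snd_sub]; ring

lemma logIncr_torusSigma_sub {α : ℝ → ℝ × ℝ} {p : ℝ × ℝ} (hα : Continuous α)
    (h : ∀ t m, α t ≠ p + latticeVector m) :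
    logIncr (fun t => torusSigma (p - α t)) = sigmaIncr α p + ((α 1).2 - (α 0).2 : ℝ) := by
  have h1 := (hasLogIncr_sigmaIncr hα h).mul
    (hasLogIncr_expUnit (h := fun t => ((α t - p).2 + 1 / 2 : ℝ)) (by fun_prop))
  have h2 : (fun t => torusSigma (α t - p) * expUnit ((α t - p).2 + 1 / 2 : ℝ)) =
      fun t => torusSigma (p - α t) := by
    funext t
    rw [← neg_sub (α t) p, torusSigma_neg, mul_comm]
  rw [h2] at h1
  refine h1.logIncr_eq.trans ?_
  push_cast [Prod.snd_sub]; ring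

/-! ### Crossing relations for paths in the plane -/

/-- Two paths whose images in the torus are disjoint do not cross each other algebraically. -/
lemma sigmaIncr_reciprocity {α β : ℝ → ℝ × ℝ} (hα : Continuous α) (hβ : Continuous β)
    (h : ∀ s t m, β t ≠ α s + latticeVector m) :
    sigmaIncr β (α 1) - sigmaIncr β (α 0) = sigmaIncr α (β 1) - sigmaIncr α (β 0) := by
  have h' : ∀ t s m, α s ≠ β t + latticeVector m := fun t s m hm => h s t (-m) <| by
    rw [hm]; simp [latticeVector, Prod.ext_iff]
  have := logIncr_square (F := fun s t => torusSigma (β t - α s))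
    (by simp only [Function.uncurry_def]; fun_prop) fun s t => torusSigma_sub_ne_zero (h s t)
  rw [logIncr_torusSigma_sub hα (h' 1), logIncr_torusSigma_sub hα (h' 0)] at this
  simp only [sigmaIncr] at this ⊢
  rw [this]; ring

/-- Logarithms of the differences of points of the torus, antisymmetric up to explicit terms. -/
lemma exists_log_torusSigma {V : Type*} [LinearOrder V] (P : V → ℝ × ℝ)
    (hP : ∀ v w, v ≠ w → ∀ m, P v ≠ P w + latticeVector m) :
    ∃ l : V → V → ℂ, (∀ v w, v ≠ w → expUnit (l v w) = torusSigma (P v - P w)) ∧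
      ∀ v w, v ≠ w →
        l v w = l w v + ((P w).2 - (P v).2 : ℝ) + 1 / 2 + (if v < w then 0 else -1) := by
  have h : ∀ v w, ∃ z, v ≠ w → expUnit z = torusSigma (P v - P w) := fun v w => by
    by_cases hvw : v = w
    · exact ⟨0, fun h => absurd hvw h⟩
    · obtain ⟨z, hz⟩ := exists_expUnit_eq (torusSigma_sub_ne_zero (hP v w hvw))
      exact ⟨z, fun _ => hz⟩
  choose l hl using h
  -- Exchanging the two points twice would add `1/2 + 1/2` to the logarithm, so no choice is
  -- symmetric; the order on `V` decides which of the two relations carries the `-1`.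
  refine ⟨fun v w => if v < w then l w v + ((P w).2 - (P v).2 : ℝ) + 1 / 2 else l v w,
    fun v w hvw => ?_, fun v w hvw => ?_⟩
  · dsimp only
    split_ifs with h
    · rw [add_assoc, expUnit_add, hl w v hvw.symm, ← neg_sub (P w), torusSigma_neg, mul_comm]
      congr 2; push_cast [Prod.snd_sub]; rfl
    · exact hl v w hvw
  · rcases lt_or_gt_of_ne hvw with h | h
    · simp only [h, h.not_gt, if_true, if_false]; ring
    · simp only [h, h.not_gt, if_true, if_false]; push_cast; ring

/-- The crossing relations of a drawing on the torus: for two independent edges `e`, `f` which do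
not cross, the homology terms and the winding numbers `k` satisfy a linear relation. -/
lemma exists_winding {V E : Type*} [LinearOrder V] (P : V → ℝ × ℝ) (a b : E → V)
    (α : E → ℝ → ℝ × ℝ) (n : E → ℤ × ℤ)
    (hP : ∀ v w, v ≠ w → ∀ m, P v ≠ P w + latticeVector m)
    (hα : ∀ e, Continuous (α e)) (h0 : ∀ e, α e 0 = P (a e))
    (h1 : ∀ e, α e 1 = P (b e) + latticeVector (n e))
    (hv : ∀ e v, v ≠ a e → v ≠ b e → ∀ t m, α e t ≠ P v + latticeVector m)
    (he : ∀ e f, a e ≠ a f → a e ≠ b f → b e ≠ a f → b e ≠ b f →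
      ∀ s t m, α f t ≠ α e s + latticeVector m) :
    ∃ k : E → V → ℤ, ∀ e f, a e ≠ a f → a e ≠ b f → b e ≠ a f → b e ≠ b f →
      k f (b e) - k f (a e) - k e (b f) + k e (a f) =
        (n f).1 * (n e).2 - (n e).1 * (n f).2 + ((if b e < b f then 0 else -1) -
          (if a e < b f then 0 else -1) - (if b e < a f then 0 else -1) +
          (if a e < a f then 0 else -1)) := by
  obtain ⟨l, hl, hl'⟩ := exists_log_torusSigma P hP
  -- Both sides are logarithms of the same quotient of end values, so they differ by an integer. At
  -- an end of `e` the value 0 is a default; it never enters a relation between independent edges.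
  have hk : ∀ e v, ∃ k : ℤ, v ≠ a e → v ≠ b e → sigmaIncr (α e) (P v) =
      l (b e) v - l (a e) v - (n e).1 * ((P (b e)).2 - (P v).2 + 1 / 2 : ℝ) + k := fun e v => by
    by_cases hva : v = a e
    · exact ⟨0, fun h => absurd hva h⟩
    by_cases hvb : v = b e
    · exact ⟨0, fun _ h => absurd hvb h⟩
    have h2 := (hasLogIncr_sigmaIncr (hα e) (hv e v hva hvb)).expUnit_mul
    rw [h0, h1, add_sub_right_comm, torusSigma_add_latticeVector, ← hl _ _ (Ne.symm hva),
      ← hl _ _ (Ne.symm hvb), ← expUnit_add, ← expUnit_add, expUnit_eq_expUnit_iff] at h2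
    obtain ⟨k, hk⟩ := h2
    refine ⟨k, fun _ _ => ?_⟩
    rw [eq_sub_of_add_eq hk]; push_cast [Prod.snd_sub]; ring
  choose k hk using hk
  refine ⟨k, fun e f haa hab hba hbb => ?_⟩
  -- Each chosen logarithm meets its reverse and cancels through `hl'`, which leaves the
  -- displacement terms and the four order terms.
  have hr := sigmaIncr_reciprocity (hα e) (hα f) (he e f haa hab hba hbb)
  rw [h0, h0, h1, h1, sigmaIncr_add_latticeVector (hα f) (hv f _ hba hbb),
    sigmaIncr_add_latticeVector (hα e) (hv e _ hab.symm hbb.symm), hk f _ hba hbb,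
    hk f _ haa hab, hk e _ hab.symm hbb.symm, hk e _ haa.symm hba.symm, h0, h0, h1, h1,
    hl' _ _ hbb, hl' _ _ hab, hl' _ _ hba, hl' _ _ haa] at hr
  have : (k f (b e) - k f (a e) - k e (b f) + k e (a f) : ℂ) =
        (n f).1 * (n e).2 - (n e).1 * (n f).2 + ((if b e < b f then 0 else -1) -
          (if a e < b f then 0 else -1) - (if b e < a f then 0 else -1) +
          (if a e < a f then 0 else -1)) := by
    simp only [latticeVector, Prod.snd_add] at hr
    push_cast at hr
    linear_combination hr
  exact_mod_cast this

/-! ### Relations modulo 2 and their inconsistency for `K₄,₅` -/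

/-- The symplectic form on `𝔽₂²`. -/
def cross (u v : ZMod 2 × ZMod 2) : ZMod 2 := u.1 * v.2 + v.1 * u.2

/-- The relations satisfied by the homology classes `v i j` and the winding numbers `kA`, `kB` of
the edges `ij` of a complete bipartite graph drawn on the torus. -/
def CrossingRelations {m n : ℕ} (v : Fin m → Fin n → ZMod 2 × ZMod 2)
    (kA : Fin m → Fin n → Fin m → ZMod 2) (kB : Fin m → Fin n → Fin n → ZMod 2) : Prop :=
  ∀ i i' j j', i ≠ i' → j ≠ j' → kB i' j' j + kA i' j' i + kB i j j' + kA i j i' =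
    cross (v i j) (v i' j') + (if i < i' then 1 else 0) + (if j < j' then 1 else 0) + 1

section

variable {m n : ℕ} {v : Fin m → Fin n → ZMod 2 × ZMod 2}
  {kA : Fin m → Fin n → Fin m → ZMod 2} {kB : Fin m → Fin n → Fin n → ZMod 2}

/-- The homology class of the cycle with vertices `i`, `j`, `i'`, `j'`. -/
def fourCycle (v : Fin m → Fin n → ZMod 2 × ZMod 2) (i i' : Fin m) (j j' : Fin n) :
    ZMod 2 × ZMod 2 := v i j + v i j' + v i' j + v i' j'

/-- Sum of the relations for the 18 pairs of independent edges of a `K₃,₃`. Every winding number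
occurs twice, and the constants add up to 1. With all classes zero this would be the non-planarity
of `K₃,₃`. -/
lemma CrossingRelations.cross_add_cross (h : CrossingRelations v kA kB) {i₀ i₁ i₂ : Fin m}
    {j₀ j₁ j₂ : Fin n} (hi : i₀ < i₁) (hi' : i₁ < i₂) (hj : j₀ < j₁) (hj' : j₁ < j₂) :
    cross (fourCycle v i₀ i₁ j₀ j₁) (fourCycle v i₀ i₂ j₀ j₂) +
      cross (fourCycle v i₀ i₁ j₀ j₂) (fourCycle v i₀ i₂ j₀ j₁) = 1 := by
  have hi₂ := hi.trans hi'
  have hj₂ := hj.trans hj'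
  have key : ∀ i i', i < i' →
      (kB i' j₁ j₀ + kA i' j₁ i + kB i j₀ j₁ + kA i j₀ i') +
      (kB i' j₀ j₁ + kA i' j₀ i + kB i j₁ j₀ + kA i j₁ i') +
      (kB i' j₂ j₀ + kA i' j₂ i + kB i j₀ j₂ + kA i j₀ i') +
      (kB i' j₀ j₂ + kA i' j₀ i + kB i j₂ j₀ + kA i j₂ i') +
      (kB i' j₂ j₁ + kA i' j₂ i + kB i j₁ j₂ + kA i j₁ i') +
      (kB i' j₁ j₂ + kA i' j₁ i + kB i j₂ j₁ + kA i j₂ i') =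
      cross (v i j₀) (v i' j₁) + cross (v i j₁) (v i' j₀) + cross (v i j₀) (v i' j₂) +
      cross (v i j₂) (v i' j₀) + cross (v i j₁) (v i' j₂) + cross (v i j₂) (v i' j₁) + 1 := by
    intro i i' hii
    rw [h i i' j₀ j₁ hii.ne hj.ne, h i i' j₁ j₀ hii.ne hj.ne', h i i' j₀ j₂ hii.ne hj₂.ne,
      h i i' j₂ j₀ hii.ne hj₂.ne', h i i' j₁ j₂ hii.ne hj'.ne, h i i' j₂ j₁ hii.ne hj'.ne']
    simp only [hii, hj, hj', hj₂, hj.not_gt, hj'.not_gt, hj₂.not_gt, if_true, if_false]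
    linear_combination (norm := (ring_nf; reduce_mod_char))
  have h1 := key i₀ i₁ hi
  have h2 := key i₀ i₂ hi₂
  have h3 := key i₁ i₂ hi'
  simp only [cross, fourCycle, Prod.fst_add, Prod.snd_add] at *
  linear_combination (norm := (ring_nf; reduce_mod_char)) h1 + h2 + h3

/-- Sum of the 16 relations between an edge of one cycle and an edge of the other, which has no
vertex in common with it. Winding numbers occur twice; the constants cancel in groups of four
because `i₀`, `i₁` precede `i₂`, `i₃`. -/
lemma CrossingRelations.cross_eq_zero (h : CrossingRelations v kA kB) {i₀ i₁ i₂ i₃ : Fin m}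
    {j₀ j₁ j₂ j₃ : Fin n} (h02 : i₀ < i₂) (h03 : i₀ < i₃) (h12 : i₁ < i₂) (h13 : i₁ < i₃)
    (hj02 : j₀ ≠ j₂) (hj03 : j₀ ≠ j₃) (hj12 : j₁ ≠ j₂) (hj13 : j₁ ≠ j₃) :
    cross (fourCycle v i₀ i₁ j₀ j₁) (fourCycle v i₂ i₃ j₂ j₃) = 0 := by
  have key : ∀ j j', j ≠ j' →
      (kB i₂ j' j + kA i₂ j' i₀ + kB i₀ j j' + kA i₀ j i₂) +
      (kB i₃ j' j + kA i₃ j' i₀ + kB i₀ j j' + kA i₀ j i₃) +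
      (kB i₂ j' j + kA i₂ j' i₁ + kB i₁ j j' + kA i₁ j i₂) +
      (kB i₃ j' j + kA i₃ j' i₁ + kB i₁ j j' + kA i₁ j i₃) =
      cross (v i₀ j) (v i₂ j') + cross (v i₀ j) (v i₃ j') +
      cross (v i₁ j) (v i₂ j') + cross (v i₁ j) (v i₃ j') := by
    intro j j' hjj
    rw [h _ _ _ _ h02.ne hjj, h _ _ _ _ h03.ne hjj, h _ _ _ _ h12.ne hjj, h _ _ _ _ h13.ne hjj]
    simp only [h02, h03, h12, h13, if_true]
    linear_combination (norm := (ring_nf; reduce_mod_char))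
  have h1 := key _ _ hj02
  have h2 := key _ _ hj03
  have h3 := key _ _ hj12
  have h4 := key _ _ hj13
  simp only [cross, fourCycle, Prod.fst_add, Prod.snd_add] at *
  linear_combination (norm := (ring_nf; reduce_mod_char)) h1 + h2 + h3 + h4

end

set_option maxRecDepth 10000 in
set_option synthInstance.maxHeartbeats 0 in
set_option synthInstance.maxSize 100000 in
/-- No four columns of three vectors of `𝔽₂²` satisfy the relations coming from `K₄,₅`. -/
lemma no_four_columns :
    -- Hypotheses are interleaved with the quantifiers so that the search is pruned early instead of
    -- running through all `4 ^ 12` cases.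
    ∀ a₁ a₂ b₁ b₂ : ZMod 2 × ZMod 2, cross a₁ b₂ + cross a₂ b₁ = 1 →
    ∀ c₁ c₂ : ZMod 2 × ZMod 2, cross a₁ c₂ + cross a₂ c₁ = 1 → cross b₁ c₂ + cross b₂ c₁ = 1 →
    ∀ a₃ b₃ : ZMod 2 × ZMod 2, cross a₁ b₃ + cross a₃ b₁ = 1 → cross a₂ b₃ + cross a₃ b₂ = 1 →
    ∀ c₃, cross a₁ c₃ + cross a₃ c₁ = 1 → cross b₁ c₃ + cross b₃ c₁ = 1 →
    cross a₂ c₃ + cross a₃ c₂ = 1 → cross b₂ c₃ + cross b₃ c₂ = 1 →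
    cross (a₁ + a₂) (b₃ + c₃) = 0 → cross (a₁ + a₃) (b₂ + c₂) = 0 →
    cross (a₂ + a₃) (b₁ + c₁) = 0 → ∀ a₄ b₄ : ZMod 2 × ZMod 2, cross a₁ b₄ + cross a₄ b₁ = 1 →
    cross a₂ b₄ + cross a₄ b₂ = 1 → cross a₃ b₄ + cross a₄ b₃ = 1 →
    cross (a₁ + a₄) (b₂ + c₂) = 0 → cross (a₁ + a₄) (b₃ + c₃) = 0 →
    cross (a₂ + a₄) (b₁ + c₁) = 0 → cross (a₂ + a₄) (b₃ + c₃) = 0 →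
    cross (a₃ + a₄) (b₁ + c₁) = 0 → cross (a₃ + a₄) (b₂ + c₂) = 0 →
    ∀ c₄, cross (a₁ + a₂) (b₄ + c₄) = 0 → cross (a₁ + a₃) (b₄ + c₄) = 0 →
    cross (a₂ + a₃) (b₄ + c₄) = 0 → cross a₁ c₄ + cross a₄ c₁ = 1 →
    cross b₁ c₄ + cross b₄ c₁ = 1 → cross a₂ c₄ + cross a₄ c₂ = 1 →
    cross b₂ c₄ + cross b₄ c₂ = 1 → cross a₃ c₄ + cross a₄ c₃ = 1 →
    cross b₃ c₄ + cross b₄ c₃ = 1 → False := by decide +kernel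

/-- There is no system of homology classes and winding numbers for `K₄,₅` on the torus. -/
lemma not_crossingRelations {v : Fin 4 → Fin 5 → ZMod 2 × ZMod 2}
    {kA : Fin 4 → Fin 5 → Fin 4 → ZMod 2} {kB : Fin 4 → Fin 5 → Fin 5 → ZMod 2} :
    ¬ CrossingRelations v kA kB := by
  intro h
  have two : ∀ u : ZMod 2 × ZMod 2, u + u = 0 := by decide
  have hA : ∀ i i' : Fin 4, ∀ j l : Fin 5, fourCycle v i i' j l =
      fourCycle v i i' 0 j + fourCycle v i i' 0 l := by
    intro i i' j l
    simp only [fourCycle]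
    linear_combination (exp := 1) -two (v i 0) - two (v i' 0)
  have hB : ∀ l : Fin 5, fourCycle v 2 3 0 l = fourCycle v 0 2 0 l + fourCycle v 0 3 0 l := by
    intro l
    simp only [fourCycle]
    linear_combination (exp := 1) -two (v 0 0) - two (v 0 l)
  have ha : ∀ (i i' : Fin 4) (j l : Fin 5), 0 < i → i < i' → 0 < j → j < l →
      cross (fourCycle v 0 i 0 j) (fourCycle v 0 i' 0 l) +
        cross (fourCycle v 0 i 0 l) (fourCycle v 0 i' 0 j) = 1 :=
    fun i i' j l hi hi' hj hj' => h.cross_add_cross hi hi' hj hj'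
  have hb : ∀ j l k : Fin 5, 0 < j → 0 < l → j ≠ k → l ≠ k →
      cross (fourCycle v 0 1 0 j + fourCycle v 0 1 0 l)
        (fourCycle v 0 2 0 k + fourCycle v 0 3 0 k) = 0 := by
    intro j l k hj hl hjk hlk
    rw [← hA, ← hB]
    exact h.cross_eq_zero (by decide) (by decide) (by decide) (by decide) hj.ne' hjk hl.ne' hlk
  -- `aⱼ`, `bⱼ`, `cⱼ` are the cycles on columns 0, `j` and on row 0 with row 1, 2, 3 respectively;
  -- `hA` and `hB` reduce the other cycles to these.
  refine no_four_columns (fourCycle v 0 1 0 1) (fourCycle v 0 1 0 2) (fourCycle v 0 2 0 1)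
    (fourCycle v 0 2 0 2) ?_ (fourCycle v 0 3 0 1) (fourCycle v 0 3 0 2) ?_ ?_
    (fourCycle v 0 1 0 3) (fourCycle v 0 2 0 3) ?_ ?_ (fourCycle v 0 3 0 3) ?_ ?_ ?_ ?_ ?_ ?_ ?_
    (fourCycle v 0 1 0 4) (fourCycle v 0 2 0 4) ?_ ?_ ?_ ?_ ?_ ?_ ?_ ?_ ?_ (fourCycle v 0 3 0 4)
    ?_ ?_ ?_ ?_ ?_ ?_ ?_ ?_ ?_ <;>
  first
  | (apply ha <;> decide)
  | (apply hb <;> decide)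

/-! ### From drawings on the torus to crossing relations -/

/-- The projection of the plane onto the torus. -/
def torusProj (z : ℝ × ℝ) : TorusSurface := (z.1, z.2)

lemma torusProj_surjective : Function.Surjective torusProj := by
  rintro ⟨x, y⟩
  obtain ⟨a, rfl⟩ := QuotientAddGroup.mk_surjective x
  obtain ⟨b, rfl⟩ := QuotientAddGroup.mk_surjective y
  exact ⟨(a, b), rfl⟩

lemma torusProj_eq_iff {z w : ℝ × ℝ} :
    torusProj z = torusProj w ↔ ∃ m, z = w + latticeVector m := by
  have h : ∀ a b : ℝ, (a : UnitAddCircle) = b ↔ ∃ n : ℤ, a = b + n := fun a b => by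
    rw [← sub_eq_zero, ← AddCircle.coe_sub, AddCircle.coe_eq_zero_iff]
    refine exists_congr fun n => ?_
    rw [zsmul_one, eq_comm, sub_eq_iff_eq_add']
  simp only [torusProj, Prod.ext_iff, h, latticeVector, Prod.fst_add, Prod.snd_add]
  exact ⟨fun ⟨⟨m, hm⟩, n, hn⟩ => ⟨(m, n), hm, hn⟩, fun ⟨m, hm, hn⟩ => ⟨⟨m.1, hm⟩, m.2, hn⟩⟩

open unitInterval in
/-- Lifting of paths of the torus to the plane. -/
lemma exists_lift_torus (c : C(I, TorusSurface)) {z : ℝ × ℝ} (hz : torusProj z = c 0) :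
    ∃ α : ℝ → ℝ × ℝ, Continuous α ∧ α 0 = z ∧
      ∀ t, torusProj (α t) = c (Set.projIcc 0 1 zero_le_one t) := by
  have key : ∀ (d : C(I, UnitAddCircle)) (x : ℝ), (x : UnitAddCircle) = d 0 →
      ∃ α : ℝ → ℝ, Continuous α ∧ α 0 = x ∧
        ∀ t, (α t : UnitAddCircle) = d (Set.projIcc 0 1 zero_le_one t) := fun d x hx => by
    -- `Set.projIcc` prolongs the path by constants to the whole line.
    obtain ⟨α, ⟨h0, h⟩, -⟩ := (AddCircle.isCoveringMap_coe (1 : ℝ)).existsUnique_continuousMap_lifts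
      ⟨fun t : ℝ => d (Set.projIcc 0 1 zero_le_one t), by fun_prop⟩ (0 : ℝ) x
      (by simpa using hx)
    exact ⟨α, α.continuous, h0, fun t => congrFun h t⟩
  obtain ⟨α, hα, hα0, h1⟩ := key ⟨fun t => (c t).1, by fun_prop⟩ z.1 (congrArg Prod.fst hz)
  obtain ⟨β, hβ, hβ0, h2⟩ := key ⟨fun t => (c t).2, by fun_prop⟩ z.2 (congrArg Prod.snd hz)
  exact ⟨fun t => (α t, β t), by fun_prop, Prod.ext hα0 hβ0, fun t => Prod.ext (h1 t) (h2 t)⟩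

open unitInterval in
/-- An edge of an embedded graph can be traversed from either of its ends. -/
lemma GraphEmbedding.exists_oriented_arc {V X : Type*} [TopologicalSpace X] {Γ : SimpleGraph V}
    (D : GraphEmbedding Γ X) {u v : V} (h : Γ.Adj u v) :
    ∃ c : C(I, X), c 0 = D.point u ∧ c 1 = D.point v ∧
      Set.range c = Set.range (D.arc ⟨s(u, v), h⟩) := by
  have := D.arc_ends ⟨s(u, v), h⟩
  rw [Sym2.map_mk, Sym2.eq_iff] at this
  rcases this with ⟨h0, h1⟩ | ⟨h0, h1⟩
  · exact ⟨_, h0, h1, rfl⟩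
  · refine ⟨(D.arc ⟨s(u, v), h⟩).comp ⟨symm, continuous_symm⟩, by simpa, by simpa, ?_⟩
    rw [ContinuousMap.coe_comp]
    exact symm_involutive.surjective.range_comp _

lemma GraphEmbedding.point_not_mem_range_arc {V X : Type*} [TopologicalSpace X]
    {Γ : SimpleGraph V} (D : GraphEmbedding Γ X) {e : Γ.edgeSet} {w : V} (hw : w ∉ e.1) :
    D.point w ∉ Set.range (D.arc e) := by
  rintro ⟨t, ht⟩
  have hmem : ∀ x ∈ s(D.arc e 0, D.arc e 1), x ≠ D.point w := fun x hx hxw => by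
    rw [D.arc_ends, Sym2.mem_map] at hx
    obtain ⟨v, hv, rfl⟩ := hx
    exact hw (D.point_injective hxw ▸ hv)
  rcases eq_or_ne t 0 with rfl | h0
  · exact hmem _ (Sym2.mem_mk_left _ _) ht
  rcases eq_or_ne t 1 with rfl | h1
  · exact hmem _ (Sym2.mem_mk_right _ _) ht
  exact D.arc_avoids_points e t ⟨unitInterval.pos_iff_ne_zero.2 h0,
    unitInterval.lt_one_iff_ne_one.2 h1⟩ w ht

/-- The arcs of two edges without a common end are disjoint. -/
lemma GraphEmbedding.disjoint_range_arc {V X : Type*} [TopologicalSpace X] {Γ : SimpleGraph V}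
    (D : GraphEmbedding Γ X) {e f : Γ.edgeSet} (h : ∀ v ∈ e.1, v ∉ f.1) :
    Disjoint (Set.range (D.arc e)) (Set.range (D.arc f)) := by
  rw [Set.disjoint_left]
  rintro _ ⟨s, rfl⟩ hs
  have hmem : ∀ x ∈ s(D.arc e 0, D.arc e 1), x ∉ Set.range (D.arc f) := fun x hx => by
    rw [D.arc_ends, Sym2.mem_map] at hx
    obtain ⟨v, hv, rfl⟩ := hx
    exact D.point_not_mem_range_arc (h v hv)
  have hmem' : ∀ x ∈ s(D.arc f 0, D.arc f 1), x ∉ Set.range (D.arc e) := fun x hx => by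
    rw [D.arc_ends, Sym2.mem_map] at hx
    obtain ⟨v, hv, rfl⟩ := hx
    exact D.point_not_mem_range_arc fun he => h v he hv
  rcases eq_or_ne s 0 with rfl | h0
  · exact hmem _ (Sym2.mem_mk_left _ _) hs
  rcases eq_or_ne s 1 with rfl | h1
  · exact hmem _ (Sym2.mem_mk_right _ _) hs
  obtain ⟨t, ht⟩ := hs
  rcases eq_or_ne t 0 with rfl | h0'
  · exact hmem' _ (Sym2.mem_mk_left _ _) ⟨s, ht.symm⟩
  rcases eq_or_ne t 1 with rfl | h1'
  · exact hmem' _ (Sym2.mem_mk_right _ _) ⟨s, ht.symm⟩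
  refine D.arc_interiors_disjoint e f ?_ s
    ⟨unitInterval.pos_iff_ne_zero.2 h0, unitInterval.lt_one_iff_ne_one.2 h1⟩ t
    ⟨unitInterval.pos_iff_ne_zero.2 h0', unitInterval.lt_one_iff_ne_one.2 h1'⟩ ht.symm
  rintro rfl
  exact h _ (Sym2.out_fst_mem e.1) (Sym2.out_fst_mem e.1)

/-- A drawing of a graph on the torus satisfies the crossing relations on every complete bipartite
subgraph. -/
lemma exists_crossingRelations {V : Type*} {Γ : SimpleGraph V} (D : GraphEmbedding Γ TorusSurface)
    {m n : ℕ} (f : Fin m → V) (g : Fin n → V) (hf : Function.Injective f)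
    (hg : Function.Injective g) (hfg : ∀ i j, Γ.Adj (f i) (g j)) :
    ∃ v kA kB, CrossingRelations (m := m) (n := n) v kA kB := by
  -- In the lexicographic sum the first side precedes the second, so comparisons across the sides
  -- contribute constants.
  let u : Fin m ⊕ₗ Fin n → V := fun x => Sum.elim f g (ofLex x)
  have hu : Function.Injective u := by
    refine Function.Injective.comp (Function.Injective.sumElim hf hg fun i j => (hfg i j).ne)
      ofLex.injective
  let a : Fin m × Fin n → Fin m ⊕ₗ Fin n := fun e => toLex (Sum.inl e.1)
  let b : Fin m × Fin n → Fin m ⊕ₗ Fin n := fun e => toLex (Sum.inr e.2)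
  have hab : ∀ e, Γ.Adj (u (a e)) (u (b e)) := fun e => hfg e.1 e.2
  choose P hP using fun x => torusProj_surjective (D.point (u x))
  choose c hc0 hc1 hc using fun e => D.exists_oriented_arc (hab e)
  choose α hα hα0 hαc using fun e => exists_lift_torus (c e) ((hP (a e)).trans (hc0 e).symm)
  have hα1 : ∀ e, ∃ n, α e 1 = P (b e) + latticeVector n := fun e => by
    rw [← torusProj_eq_iff, hαc, hP, ← hc1]; simp
  choose N hN using hα1
  have hmem : ∀ e t, torusProj (α e t) ∈ Set.range (D.arc ⟨_, hab e⟩) := fun e t => by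
    rw [hαc, ← hc]; exact Set.mem_range_self _
  obtain ⟨k, hk⟩ := exists_winding P a b α N
    (fun v w hvw m h => hvw <| hu <| D.point_injective <| by
      rw [← hP, ← hP]; exact torusProj_eq_iff.2 ⟨m, h⟩) hα hα0 hN
    (fun e v hva hvb t m h => by
      have h1 := hmem e t
      rw [torusProj_eq_iff.2 ⟨m, h⟩, hP] at h1
      exact D.point_not_mem_range_arc (by simp [hu.eq_iff, hva, hvb]) h1)
    (fun e f haa hab' hba hbb s t m h => by
      have h1 := hmem f t
      rw [torusProj_eq_iff.2 ⟨m, h⟩] at h1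
      refine (D.disjoint_range_arc ?_).le_bot ⟨hmem e s, h1⟩
      simp [hu.eq_iff, haa, hab', hba, hbb])
  refine ⟨fun i j => ((N (i, j)).1, (N (i, j)).2), fun i j i' => k (i, j) (a (i', j)),
    fun i j j' => k (i, j) (b (i, j')), fun i i' j j' hi hj => ?_⟩
  have := congrArg (Int.cast : ℤ → ZMod 2) (hk (i, j) (i', j') (by simpa [a] using hi)
    (by simp [a, b]) (by simp [a, b]) (by simpa [b] using hj))
  simp only [a, b, Sum.Lex.inl_lt_inl_iff, Sum.Lex.inr_lt_inr_iff, Sum.Lex.inl_lt_inr,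
    Sum.Lex.not_inr_lt_inl, if_true, if_false] at this
  simp only [cross, a, b]
  push_cast at this
  split_ifs at this ⊢ <;>
    linear_combination (norm := (ring_nf; reduce_mod_char)) this

/-- A graph with a subgraph `K₄,₅` does not embed in the torus. -/
theorem not_embedsIn_torus {V : Type*} {Γ : SimpleGraph V} (f : Fin 4 → V) (g : Fin 5 → V)
    (hf : Function.Injective f) (hg : Function.Injective g) (hfg : ∀ i j, Γ.Adj (f i) (g j)) :
    ¬ EmbedsIn Γ TorusSurface := fun ⟨D⟩ => by
  obtain ⟨v, kA, kB, h⟩ := exists_crossingRelations D f g hf hg hfg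
  exact not_crossingRelations h

/-- An injective homomorphism of graphs transports embeddings. -/
lemma EmbedsIn.of_injective_hom {V W X : Type*} [TopologicalSpace X] {Γ : SimpleGraph V}
    {Δ : SimpleGraph W} (f : Γ →g Δ) (hf : Function.Injective f) (h : EmbedsIn Δ X) :
    EmbedsIn Γ X := by
  obtain ⟨D⟩ := h
  have hinj := SimpleGraph.Hom.mapEdgeSet.injective f hf
  exact ⟨{
    point := D.point ∘ f
    arc := D.arc ∘ f.mapEdgeSet
    point_injective := D.point_injective.comp hf
    arc_injective := fun e => D.arc_injective _
    arc_ends := fun e => by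
      rw [Sym2.map_comp]
      exact D.arc_ends (f.mapEdgeSet e)
    arc_avoids_points := fun e t ht v => D.arc_avoids_points _ t ht _
    arc_interiors_disjoint := fun e e' h s hs t ht =>
      D.arc_interiors_disjoint _ _ (hinj.ne h) s hs t ht }⟩

/-! ### Drawings on the sphere by radial projection -/

/-- The radial projection to the unit sphere. -/
noncomputable def radialProj (x : {x : EuclideanSpace ℝ (Fin 3) // x ≠ 0}) : SphereSurface :=
  ⟨‖x.1‖⁻¹ • x.1, by simp [norm_smul, x.2]⟩

lemma continuous_radialProj : Continuous radialProj := by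
  unfold radialProj
  refine Continuous.subtype_mk ?_ _
  exact (continuous_subtype_val.norm.inv₀ fun x => norm_ne_zero_iff.2 x.2).smul
    continuous_subtype_val

lemma exists_pos_smul_of_radialProj_eq {x y : {x : EuclideanSpace ℝ (Fin 3) // x ≠ 0}}
    (h : radialProj x = radialProj y) : ∃ r : ℝ, 0 < r ∧ x.1 = r • y.1 := by
  have hx := norm_pos_iff.2 x.2
  refine ⟨‖x.1‖ * ‖y.1‖⁻¹, mul_pos hx (inv_pos.2 (norm_pos_iff.2 y.2)), ?_⟩
  have h' : ‖x.1‖⁻¹ • x.1 = ‖y.1‖⁻¹ • y.1 := congrArg Subtype.val h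
  rw [mul_smul, ← h', smul_inv_smul₀ hx.ne']

/-- Radial projection of a straight-line drawing: if a function `sig` on the space, constant on
open rays, is constant on open edges and separates the vertices and the open edges, the drawing
projects to an embedding in the sphere. -/
lemma embedsIn_sphere_of_separating {V S : Type*} {Γ : SimpleGraph V}
    (P : V → EuclideanSpace ℝ (Fin 3)) (sig : EuclideanSpace ℝ (Fin 3) → S)
    (hsig : ∀ r : ℝ, 0 < r → ∀ x, sig (r • x) = sig x)
    (hseg : ∀ u v, Γ.Adj u v → ∀ t ∈ Set.Ioo (0 : ℝ) 1,
      sig ((1 - t) • P u + t • P v) = sig (P u + P v))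
    (hV0 : ∀ v, sig (P v) ≠ sig 0) (hE0 : ∀ u v, Γ.Adj u v → sig (P u + P v) ≠ sig 0)
    (hV : Function.Injective fun v => sig (P v))
    (hVE : ∀ u v w, Γ.Adj u v → sig (P u + P v) ≠ sig (P w))
    (hE : ∀ u v u' v', Γ.Adj u v → Γ.Adj u' v' → sig (P u + P v) = sig (P u' + P v') →
      s(u, v) = s(u', v')) :
    EmbedsIn Γ SphereSurface := by
  have hP : ∀ v, P v ≠ 0 := fun v h => hV0 v (by rw [h])
  have hends : ∀ e : Γ.edgeSet, ∃ u v, Γ.Adj u v ∧ e.1 = s(u, v) := by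
    rintro ⟨e, he⟩
    induction e using Sym2.ind with | _ u v => exact ⟨u, v, he, rfl⟩
  choose a b hab heab using hends
  have hL : ∀ (e : Γ.edgeSet) (t : unitInterval),
      (1 - t : ℝ) • P (a e) + (t : ℝ) • P (b e) ≠ 0 := by
    intro e t h
    rcases eq_or_ne t 0 with rfl | h0
    · exact hP (a e) (by simpa using h)
    rcases eq_or_ne t 1 with rfl | h1
    · exact hP (b e) (by simpa using h)
    refine hE0 _ _ (hab e) ?_
    rw [← hseg _ _ (hab e) t ⟨unitInterval.pos_iff_ne_zero.2 h0,
      unitInterval.lt_one_iff_ne_one.2 h1⟩, h]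
  let pt : V → SphereSurface := fun v => radialProj ⟨P v, hP v⟩
  let γ : Γ.edgeSet → C(unitInterval, SphereSurface) := fun e =>
    ⟨fun t => radialProj ⟨(1 - t : ℝ) • P (a e) + (t : ℝ) • P (b e), hL e t⟩,
      continuous_radialProj.comp (Continuous.subtype_mk (by fun_prop) _)⟩
  have hproj : ∀ x y, radialProj x = radialProj y → sig x.1 = sig y.1 := fun x y h => by
    obtain ⟨r, hr, hxy⟩ := exists_pos_smul_of_radialProj_eq h
    rw [hxy, hsig r hr]
  refine ⟨⟨pt, γ, fun u v h => hV (hproj _ _ h), fun e s t hst => ?_, fun e => ?_,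
    fun e t ht v h => ?_, fun e e' hne s hs t ht h => ?_⟩⟩
  -- Two distinct points of an edge on one ray make its ends proportional. Opposite ends would put
  -- the origin on the edge; ends on one ray would have the same `sig`.
  · obtain ⟨r, hr, h⟩ := exists_pos_smul_of_radialProj_eq hst
    dsimp only at h
    set p := P (a e) with hp
    set q := P (b e) with hq
    set A : ℝ := 1 - s - r * (1 - t) with hA
    set B : ℝ := s - r * t with hB
    have hAB : A • p + B • q = 0 := by
      rw [← sub_eq_zero.2 h]; module
    rcases eq_or_ne A 0 with hA0 | hA0
    · rw [hA0, zero_smul, zero_add, smul_eq_zero, or_iff_left (hP _)] at hAB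
      have hr1 : r = 1 := by linear_combination -hA0 - hAB
      exact Subtype.ext (by rw [hB, hr1] at hAB; linarith)
    exfalso
    have hpq : p = (-(B / A)) • q := by
      rw [neg_smul, div_eq_inv_mul, mul_smul, ← smul_neg, ← eq_neg_of_add_eq_zero_left hAB,
        inv_smul_smul₀ hA0]
    generalize B / A = c at hpq
    rcases lt_trichotomy (-c) 0 with hlt | h0 | hgt
    · have hpos : 0 < 1 + c := by linarith
      have hc : 0 < c := by linarith
      -- This parameter solves `(1 - t) * (-c) + t = 0`.
      refine hL e ⟨c / (1 + c), by positivity, (div_le_one hpos).2 (by linarith)⟩ ?_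
      rw [← hp, ← hq, hpq, smul_smul, ← add_smul]
      convert zero_smul ℝ q
      field_simp
      ring
    · exact hP (a e) (by rw [← hp, hpq, h0, zero_smul])
    · refine (hab e).ne (hV ?_)
      dsimp only
      rw [← hp, hpq, hsig _ hgt]
  · rw [heab, Sym2.map_mk]
    simp [γ, pt]
  · refine hVE _ _ v (hab e) ?_
    rw [← hseg _ _ (hab e) t ht]
    exact hproj _ _ h
  · refine hne (Subtype.ext ?_)
    rw [heab, heab e']
    refine hE _ _ _ _ (hab e) (hab e') ?_
    rw [← hseg _ _ (hab e) s hs, ← hseg _ _ (hab e') t ht]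
    exact hproj _ _ h

/-- The graph of the octahedron. -/
def octahedron : SimpleGraph (Fin 3 × Bool) where
  Adj x y := x.1 ≠ y.1
  symm := ⟨fun _ _ h => h.symm⟩
  loopless := ⟨fun _ h => h rfl⟩

/-- The graph of the triangular bipyramid, the complete graph on five vertices less an edge. -/
def bipyramid : SimpleGraph (Fin 5) where
  Adj x y := x ≠ y ∧ (x < 3 ∨ y < 3)
  symm := ⟨fun _ _ h => ⟨h.1.symm, h.2.symm⟩⟩
  loopless := ⟨fun _ h => h.1 rfl⟩

/-- The point with given integral coordinates. -/
noncomputable def integralPoint (c : Fin 3 → ℤ) : EuclideanSpace ℝ (Fin 3) :=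
  WithLp.toLp 2 fun i => (c i : ℝ)

lemma integralPoint_add (c d : Fin 3 → ℤ) :
    integralPoint c + integralPoint d = integralPoint (c + d) := by
  ext i; simp [integralPoint]

lemma integralPoint_zero : integralPoint 0 = 0 := by
  ext i; simp [integralPoint]

/-- `embedsIn_sphere_of_separating` for a drawing with integral vertices, where the values of the
separating function on integral points are computable. -/
lemma embedsIn_sphere_of_integral {V S : Type*} {Γ : SimpleGraph V} (c : V → Fin 3 → ℤ)
    (sig : EuclideanSpace ℝ (Fin 3) → S) (sigZ : (Fin 3 → ℤ) → S)
    (hZ : ∀ x, sig (integralPoint x) = sigZ x)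
    (hsig : ∀ r : ℝ, 0 < r → ∀ x, sig (r • x) = sig x)
    (hseg : ∀ u v, Γ.Adj u v → ∀ t ∈ Set.Ioo (0 : ℝ) 1,
      sig ((1 - t) • integralPoint (c u) + t • integralPoint (c v)) = sigZ (c u + c v))
    (hV0 : ∀ v, sigZ (c v) ≠ sigZ 0) (hE0 : ∀ u v, Γ.Adj u v → sigZ (c u + c v) ≠ sigZ 0)
    (hV : ∀ v w, sigZ (c v) = sigZ (c w) → v = w)
    (hVE : ∀ u v w, Γ.Adj u v → sigZ (c u + c v) ≠ sigZ (c w))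
    (hE : ∀ u v u' v', Γ.Adj u v → Γ.Adj u' v' → sigZ (c u + c v) = sigZ (c u' + c v') →
      u = u' ∧ v = v' ∨ u = v' ∧ v = u') :
    EmbedsIn Γ SphereSurface := by
  refine embedsIn_sphere_of_separating (fun v => integralPoint (c v)) sig hsig ?_ ?_ ?_ ?_ ?_ ?_
  all_goals simp only [← integralPoint_zero, integralPoint_add, hZ]
  · exact hseg
  · exact hV0
  · exact hE0
  · exact fun v w h => hV v w h
  · exact hVE
  · exact fun u v u' v' h h' he => Sym2.eq_iff.2 (hE u v u' v' h h' he)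

instance : DecidableRel octahedron.Adj := fun x y => inferInstanceAs (Decidable (x.1 ≠ y.1))

instance : DecidableRel bipyramid.Adj := fun x y =>
  inferInstanceAs (Decidable (x ≠ y ∧ (x < 3 ∨ y < 3)))

set_option synthInstance.maxHeartbeats 0 in
set_option synthInstance.maxSize 100000 in
lemma octahedron_embedsIn_sphere : EmbedsIn octahedron SphereSurface := by
  refine embedsIn_sphere_of_integral
    -- The vertices are plus and minus the basis vectors; sign vectors tell apart the open cones
    -- over the faces.
    (fun v i => if i = v.1 then (if v.2 then 1 else -1) else 0)
    (fun x i => SignType.sign (x i)) (fun x i => SignType.sign (x i)) ?_ ?_ ?_ ?_ ?_ ?_ ?_ ?_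
  · intro x
    funext i
    simp [integralPoint, sign_intCast]
  · intro r hr x
    funext i
    simp [sign_mul, sign_pos hr]
  · rintro ⟨i, b⟩ ⟨j, b'⟩ h t ⟨ht0, ht1⟩
    have h1 : 0 < 1 - t := sub_pos.2 ht1
    replace h : i ≠ j := h
    funext k
    rcases eq_or_ne k i with rfl | hi
    · cases b <;> simp [integralPoint, h, h1, ht1]
    rcases eq_or_ne k j with rfl | hj
    · cases b' <;> simp [integralPoint, hi, ht0]
    · simp [integralPoint, hi, hj]
  · decide
  · decide
  · decide
  · decide
  · decide +kernel

/-- The three equatorial vertices have sum zero, so a horizontal vector has unique coordinates in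
them with minimum 0. The first three tests tell which coordinates are positive, the last two give
the sign of the height. -/
lemma bipyramid_embedsIn_sphere : EmbedsIn bipyramid SphereSurface := by
  refine embedsIn_sphere_of_integral
    (![![1, 0, 0], ![0, 1, 0], ![-1, -1, 0], ![0, 0, 1], ![0, 0, -1]])
    (fun x => ![decide (x 1 < x 0 ∨ 0 < x 0), decide (x 0 < x 1 ∨ 0 < x 1),
      decide (x 0 < 0 ∨ x 1 < 0), decide (0 < x 2), decide (x 2 < 0)])
    (fun x => ![decide (x 1 < x 0 ∨ 0 < x 0), decide (x 0 < x 1 ∨ 0 < x 1),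
      decide (x 0 < 0 ∨ x 1 < 0), decide (0 < x 2), decide (x 2 < 0)]) ?_ ?_ ?_ ?_ ?_ ?_ ?_ ?_
  · intro x
    simp [integralPoint]
  · intro r hr x
    simp [hr, mul_neg_iff, hr.not_gt]
  · intro u v h t ⟨ht0, ht1⟩
    have h1 : 0 < 1 - t := sub_pos.2 ht1
    fin_cases u <;> fin_cases v <;> first
    | exact absurd h (by decide)
    | simp [integralPoint, ht0, ht1, ht0.not_gt, ht1.not_gt]
  · decide
  · decide
  · decide
  · decide
  · decide +kernel

/-! ### Centralizers, and `K₄,₅` in groups of order at least 9 -/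

section

variable {G : Type*} [Group G]

/-- A group whose quotient by its center has order less than four is commutative. -/
lemma mul_comm_of_index_center_lt_four [Finite G] (h : (Subgroup.center G).index < 4) (x y : G) :
    x * y = y * x := by
  have h0 : (Subgroup.center G).index ≠ 0 := Subgroup.index_ne_zero_of_finite
  have hc : IsCyclic (G ⧸ Subgroup.center G) := by
    have hp : ∀ p : ℕ, p.Prime → (Subgroup.center G).index = p →
        IsCyclic (G ⧸ Subgroup.center G) := fun p hp h =>
      have := Fact.mk hp
      isCyclic_of_prime_card (p := p) h
    interval_cases hi : (Subgroup.center G).index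
    · exact absurd rfl h0
    · have : Subsingleton (G ⧸ Subgroup.center G) := (Nat.card_eq_one_iff_unique.1 hi).1
      infer_instance
    · exact hp 2 Nat.prime_two rfl
    · exact hp 3 Nat.prime_three rfl
  exact (isMulCommutative_of_isCyclic_quotient_center_self G).is_comm.comm x y

lemma four_mul_card_center_le [Finite G] (hG : ∃ x y : G, x * y ≠ y * x) :
    4 * Nat.card (Subgroup.center G) ≤ Nat.card G := by
  obtain ⟨x, y, hxy⟩ := hG
  rw [← Subgroup.index_mul_card (Subgroup.center G)]
  exact Nat.mul_le_mul_right _ (not_lt.1 fun h => hxy (mul_comm_of_index_center_lt_four h x y))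

lemma mem_center_of_centralizer_eq_top {a : G} (h : Subgroup.centralizer {a} = ⊤) :
    a ∈ Subgroup.center G :=
  Subgroup.mem_center_iff.2 fun g =>
    Subgroup.mem_centralizer_singleton_iff.1 (by rw [h]; exact Subgroup.mem_top g)

lemma one_lt_index_centralizer [Finite G] {a : G} (ha : a ∉ Subgroup.center G) :
    1 < (Subgroup.centralizer {a}).index := by
  have h0 : (Subgroup.centralizer {a}).index ≠ 0 := Subgroup.index_ne_zero_of_finite
  have h1 : (Subgroup.centralizer {a}).index ≠ 1 := fun h =>
    ha (mem_center_of_centralizer_eq_top (Subgroup.index_eq_one.1 h))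
  omega

lemma two_mul_card_centralizer_le [Finite G] {a : G} (ha : a ∉ Subgroup.center G) :
    2 * Nat.card (Subgroup.centralizer {a}) ≤ Nat.card G := by
  rw [← Subgroup.index_mul_card (Subgroup.centralizer {a})]
  exact Nat.mul_le_mul_right _ (one_lt_index_centralizer ha)

lemma card_centralizer_eq_or_le [Finite G] {a : G} (ha : a ∉ Subgroup.center G) :
    2 * Nat.card (Subgroup.centralizer {a}) = Nat.card G ∨
      3 * Nat.card (Subgroup.centralizer {a}) ≤ Nat.card G := by
  rw [← Subgroup.index_mul_card (Subgroup.centralizer {a})]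
  rcases (Nat.succ_le_of_lt (one_lt_index_centralizer ha)).eq_or_lt with h | h
  · exact Or.inl (by rw [← h])
  · exact Or.inr (Nat.mul_le_mul_right _ h)

lemma centralizer_mul_right_of_mem_center (a : G) {z : G} (hz : z ∈ Subgroup.center G) :
    Subgroup.centralizer {a * z} = Subgroup.centralizer {a} := by
  ext g
  rw [Subgroup.mem_centralizer_singleton_iff, Subgroup.mem_centralizer_singleton_iff, mul_assoc,
    ← Subgroup.mem_center_iff.1 hz g, ← mul_assoc, ← mul_assoc, mul_left_inj]

lemma centralizer_inv_singleton (a : G) :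
    Subgroup.centralizer {a⁻¹} = Subgroup.centralizer {a} := by
  ext g
  rw [Subgroup.mem_centralizer_singleton_iff, Subgroup.mem_centralizer_singleton_iff]
  exact Commute.inv_right_iff (a := g) (b := a)

/-- The number of elements outside of two subgroups. -/
lemma card_sub_mul_card_sub_le [Finite G] (H K : Subgroup G) :
    (Nat.card G - Nat.card H) * (Nat.card G - Nat.card K) ≤
      Nat.card G * ((H : Set G) ∪ K)ᶜ.ncard := by
  have h1 := Set.ncard_union_add_ncard_inter (H : Set G) K
  have h2 := Set.ncard_add_ncard_compl ((H : Set G) ∪ K)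
  have h3 : Nat.card H * Nat.card K ≤ Nat.card G * Nat.card (H ⊓ K : Subgroup G) := by
    have hi := Subgroup.index_inf_le (H := H) (K := K)
    have hH := Subgroup.index_mul_card H
    have hK := Subgroup.index_mul_card K
    have hHK := Subgroup.index_mul_card (H ⊓ K)
    have hpos : 0 < H.index * K.index :=
      Nat.mul_pos (Nat.pos_of_ne_zero Subgroup.index_ne_zero_of_finite)
        (Nat.pos_of_ne_zero Subgroup.index_ne_zero_of_finite)
    refine Nat.le_of_mul_le_mul_left ?_ hpos
    calc H.index * K.index * (Nat.card H * Nat.card K)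
        = (H.index * Nat.card H) * (K.index * Nat.card K) := by ring
      _ = Nat.card G * ((H ⊓ K).index * Nat.card (H ⊓ K : Subgroup G)) := by rw [hH, hK, hHK]
      _ ≤ Nat.card G * ((H.index * K.index) * Nat.card (H ⊓ K : Subgroup G)) := by gcongr
      _ = _ := by ring
  have e : ∀ L : Subgroup G, (L : Set G).ncard = Nat.card L := fun L => rfl
  rw [← Subgroup.coe_inf, e, e, e] at h1
  have hH := Subgroup.card_le_card_group H
  have hK := Subgroup.card_le_card_group K
  zify [hH, hK]
  zify at h1 h2 h3
  nlinarith

lemma not_embedsIn_torus_of_sets [Finite G] {A B : Set G} (hA : 4 ≤ A.ncard) (hB : 5 ≤ B.ncard)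
    (h : ∀ a ∈ A, ∀ b ∈ B, a * b ≠ b * a) : ¬ EmbedsIn (nonCommutingGraph G) TorusSurface := by
  have key : ∀ (n : ℕ) (S : Set G), n ≤ S.ncard → Nonempty (Fin n ↪ S) := fun n S hS => by
    have := Fintype.ofFinite S
    refine Function.Embedding.nonempty_of_card_le ?_
    rwa [Fintype.card_fin, ← Nat.card_eq_fintype_card]
  obtain ⟨f⟩ := key 4 A hA
  obtain ⟨g⟩ := key 5 B hB
  have hf : ∀ i, (f i : G) ∉ Subgroup.center G := fun i hi =>
    h _ (f i).2 _ (g 0).2 (Subgroup.mem_center_iff.1 hi _).symm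
  have hg : ∀ j, (g j : G) ∉ Subgroup.center G := fun j hj =>
    h _ (f 0).2 _ (g j).2 (Subgroup.mem_center_iff.1 hj _)
  exact not_embedsIn_torus (fun i => ⟨f i, hf i⟩) (fun j => ⟨g j, hg j⟩)
    (fun i i' hi => f.injective (Subtype.ext (congrArg (fun v => v.1) hi)))
    (fun i i' hi => g.injective (Subtype.ext (congrArg (fun v => v.1) hi)))
    (fun i j => h _ (f i).2 _ (g j).2)

lemma exists_notMem_of_ncard_lt {α : Type*} {S : Set α} (h : S.ncard < Nat.card α) :
    ∃ x, x ∉ S := by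
  by_contra! hS
  rw [Set.eq_univ_of_forall hS, Set.ncard_univ] at h
  exact lt_irrefl _ h

/-- In a group of order at least `9`, if at most two elements have a square different from `1`,
all have square `1`. -/
lemma sq_eq_one_of_forall [Finite G] (hn : 9 ≤ Nat.card G) {a : G}
    (h : ∀ b, b ≠ a → b ≠ a⁻¹ → b * b = 1) : a * a = 1 := by
  -- For `t ∉ S` neither `t` nor `t * a` is `a` or `a⁻¹`, so both have square 1 and `t` inverts `a`.
  let S : Set G := {1, a, a⁻¹, a⁻¹ * a⁻¹}
  have hS : S.ncard ≤ 4 := by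
    refine (Set.ncard_insert_le _ _).trans (Nat.succ_le_succ ?_)
    refine (Set.ncard_insert_le _ _).trans (Nat.succ_le_succ ?_)
    refine (Set.ncard_insert_le _ _).trans (Nat.succ_le_succ ?_)
    exact (Set.ncard_singleton _).le
  have good : ∀ t, t ∉ S → t * t = 1 ∧ t * a * t = a⁻¹ := by
    intro t ht
    simp only [S, Set.mem_insert_iff, Set.mem_singleton_iff, not_or] at ht
    obtain ⟨h1, h2, h3, h4⟩ := ht
    refine ⟨h t h2 h3, ?_⟩
    have := h (t * a) (fun h => h1 (by simpa using h))
      (fun h => h4 (eq_mul_inv_of_mul_eq h))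
    exact eq_inv_of_mul_eq_one_left (by rw [← this]; group)
  obtain ⟨t, ht⟩ := exists_notMem_of_ncard_lt (S := S) (by omega)
  -- At most 8 elements are to be avoided for `s` and `t * s` to lie outside `S`. Then `t * s`
  -- inverts `a`, and also centralizes it as a product of two inverting elements.
  obtain ⟨s, hs⟩ := exists_notMem_of_ncard_lt (S := S ∪ (fun x => t⁻¹ * x) '' S) (by
    have h1 := Set.ncard_union_le S ((fun x => t⁻¹ * x) '' S)
    have h2 := Set.ncard_image_le (f := fun x => t⁻¹ * x) (Set.toFinite S)
    omega)
  have hs1 : s ∉ S := fun h => hs (Or.inl h)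
  have hts : t * s ∉ S := fun h => hs (Or.inr ⟨_, h, inv_mul_cancel_left t s⟩)
  obtain ⟨ht2, hta⟩ := good t ht
  obtain ⟨hs2, hsa⟩ := good s hs1
  obtain ⟨hts2, htsa⟩ := good _ hts
  have hcomm : t * s = s * t := by
    rw [← inv_eq_of_mul_eq_one_left hts2, mul_inv_rev, inv_eq_of_mul_eq_one_left hs2,
      inv_eq_of_mul_eq_one_left ht2]
  have h1 : t * s * a * (t * s) = a := by
    nth_rewrite 2 [hcomm]
    calc t * s * a * (s * t) = t * (s * a * s) * t := by group
      _ = t * a⁻¹ * t := by rw [hsa]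
      _ = (t⁻¹ * a * t⁻¹)⁻¹ := by group
      _ = a := by rw [inv_eq_of_mul_eq_one_left ht2, hta, inv_inv]
  rw [h1] at htsa
  exact mul_eq_one_iff_eq_inv.2 htsa

/-- Two disjoint pairs of non-central elements with the same centralizers. -/
lemma exists_pairs [Finite G] (hG : ∃ x y : G, x * y ≠ y * x) (hn : 9 ≤ Nat.card G) :
    ∃ a a' b b' : G, ({a, a', b, b'} : Set G).ncard = 4 ∧
      Subgroup.centralizer {a'} = Subgroup.centralizer {a} ∧
      Subgroup.centralizer {b'} = Subgroup.centralizer {b} ∧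
      a ∉ Subgroup.center G ∧ b ∉ Subgroup.center G := by
  have four : ∀ {a a' b b' : G}, a ≠ a' → a ≠ b → a ≠ b' → a' ≠ b → a' ≠ b' → b ≠ b' →
      ({a, a', b, b'} : Set G).ncard = 4 := by
    intro a a' b b' h1 h2 h3 h4 h5 h6
    rw [Set.ncard_insert_of_notMem (by simp [*]), Set.ncard_insert_of_notMem (by simp [*]),
      Set.ncard_pair h6]
  obtain ⟨x, y, hxy⟩ := id hG
  have hc := four_mul_card_center_le hG
  have hx : x ∉ Subgroup.center G := fun h => hxy (Subgroup.mem_center_iff.1 h y).symm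
  by_cases hZ : Subgroup.center G = ⊥
  -- With trivial center the pairs are `a, a⁻¹` and `b, b⁻¹`; if there are no two such pairs, all
  -- squares are 1 and `G` is commutative.
  · have hZ' : ∀ a : G, a * a ≠ 1 → a ∉ Subgroup.center G := fun a ha h => by
      rw [hZ, Subgroup.mem_bot] at h
      exact ha (by rw [h, mul_one])
    have hinv : ∀ a : G, a * a ≠ 1 → a ≠ a⁻¹ := fun a ha h => ha (mul_eq_one_iff_eq_inv.2 h)
    by_cases hT : ∃ a b : G, a * a ≠ 1 ∧ b * b ≠ 1 ∧ b ≠ a ∧ b ≠ a⁻¹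
    · obtain ⟨a, b, ha, hb, hba, hba'⟩ := hT
      refine ⟨a, a⁻¹, b, b⁻¹, four (hinv a ha) hba.symm ?_ hba'.symm (inv_injective.ne hba.symm)
        (hinv b hb), centralizer_inv_singleton a, centralizer_inv_singleton b, hZ' a ha, hZ' b hb⟩
      exact fun h => hba' (by rw [h, inv_inv])
    · push Not at hT
      have hsq : ∀ a : G, a * a = 1 := fun a => by
        by_contra ha
        refine ha (sq_eq_one_of_forall hn fun b hb hb' => ?_)
        by_contra hbb
        exact hb' (hT a b ha hbb hb)
      have hself : ∀ a : G, a⁻¹ = a := fun a => inv_eq_of_mul_eq_one_left (hsq a)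
      exact absurd (by rw [← hself (x * y), mul_inv_rev, hself, hself]) hxy
  · obtain ⟨z, hz, hz1⟩ := (Subgroup.bot_or_exists_ne_one (Subgroup.center G)).resolve_left hZ
    -- The pairs are `x, x * z` and `b, b * z`; avoiding `x * z⁻¹` ensures `b * z ≠ x`.
    let S : Set G := (Subgroup.center G : Set G) ∪ {x, x * z, x * z⁻¹}
    obtain ⟨b, hb⟩ := exists_notMem_of_ncard_lt (S := S) (by
      have h1 : S.ncard ≤ Nat.card (Subgroup.center G) + _ :=
        Set.ncard_union_le (Subgroup.center G : Set G) {x, x * z, x * z⁻¹}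
      have h3 : ({x, x * z, x * z⁻¹} : Set G).ncard ≤ 3 := by
        refine (Set.ncard_insert_le _ _).trans (Nat.succ_le_succ ?_)
        refine (Set.ncard_insert_le _ _).trans (Nat.succ_le_succ ?_)
        exact (Set.ncard_singleton _).le
      omega)
    simp only [S, Set.mem_union, SetLike.mem_coe, Set.mem_insert_iff, Set.mem_singleton_iff,
      not_or] at hb
    obtain ⟨hbZ, h1, h2, h3⟩ := hb
    refine ⟨x, x * z, b, b * z, four (by simpa using hz1) (Ne.symm h1) ?_ (Ne.symm h2)
      (by simpa using Ne.symm h1) (by simpa using hz1),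
      centralizer_mul_right_of_mem_center x hz, centralizer_mul_right_of_mem_center b hz, hx, hbZ⟩
    exact fun h => h3 (eq_mul_inv_of_mul_eq h.symm)

lemma not_embedsIn_torus_of_pairs [Finite G] {a a' b b' : G}
    (h4 : ({a, a', b, b'} : Set G).ncard = 4)
    (ha : Subgroup.centralizer {a'} = Subgroup.centralizer {a})
    (hb : Subgroup.centralizer {b'} = Subgroup.centralizer {b})
    (h : 4 * Nat.card G < (Nat.card G - Nat.card (Subgroup.centralizer {a})) *
      (Nat.card G - Nat.card (Subgroup.centralizer {b}))) :
    ¬ EmbedsIn (nonCommutingGraph G) TorusSurface := by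
  have h1 := h.trans_le (card_sub_mul_card_sub_le _ _)
  rw [mul_comm] at h1
  refine not_embedsIn_torus_of_sets h4.ge (Nat.lt_of_mul_lt_mul_left h1) ?_
  intro c hc d hd hcd
  rw [Set.mem_compl_iff, Set.mem_union, SetLike.mem_coe, SetLike.mem_coe] at hd
  have hcd' := Subgroup.mem_centralizer_singleton_iff.2 hcd.symm
  rcases hc with rfl | rfl | rfl | rfl
  · exact hd (Or.inl hcd')
  · exact hd (Or.inl (ha ▸ hcd'))
  · exact hd (Or.inr hcd')
  · exact hd (Or.inr (hb ▸ hcd'))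

end

section

variable {G : Type*} [Group G]

/-- An abelian subgroup of index two gives a complete bipartite subgraph. -/
lemma not_embedsIn_torus_of_abelian_index_two [Finite G] {H : Subgroup G}
    (hH : ∀ x ∈ H, ∀ y ∈ H, x * y = y * x) (h2 : 2 * Nat.card H = Nat.card G)
    (hZ : Subgroup.center G ≤ H) (h4 : Nat.card (Subgroup.center G) + 4 ≤ Nat.card H)
    (h5 : 5 ≤ Nat.card H) : ¬ EmbedsIn (nonCommutingGraph G) TorusSurface := by
  refine not_embedsIn_torus_of_sets (A := (H : Set G) \ Subgroup.center G) (B := (H : Set G)ᶜ)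
    ?_ ?_ ?_
  · have h := Set.ncard_sdiff_add_ncard_of_subset (s := (Subgroup.center G : Set G)) (t := H) hZ
    have e : ∀ L : Subgroup G, (L : Set G).ncard = Nat.card L := fun L => rfl
    rw [e, e] at h
    omega
  · have h := Set.ncard_add_ncard_compl (H : Set G)
    have e : ∀ L : Subgroup G, (L : Set G).ncard = Nat.card L := fun L => rfl
    rw [e] at h
    omega
  · rintro a ⟨ha, haZ⟩ b hb hab
    have hle : H ≤ Subgroup.centralizer {a} := fun x hx =>
      Subgroup.mem_centralizer_singleton_iff.2 (hH x hx a ha)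
    have heq := Subgroup.eq_of_le_of_card_ge hle (by
      have := two_mul_card_centralizer_le (a := a) haZ
      omega)
    exact hb (heq ▸ Subgroup.mem_centralizer_singleton_iff.2 hab.symm)

/-- If the centralizer of a non-central element is abelian of index two and the center has index
two in it, the order of the center is even. -/
lemma card_center_ne_three [Finite G] {a : G} (ha : a ∉ Subgroup.center G)
    (h2 : 2 * Nat.card (Subgroup.centralizer {a}) = Nat.card G)
    (hZ : 2 * Nat.card (Subgroup.center G) = Nat.card (Subgroup.centralizer {a})) :
    Nat.card (Subgroup.center G) ≠ 3 := by
  intro h3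
  set H := Subgroup.centralizer {a} with hH
  have hHi : H.index = 2 := by
    have := Subgroup.index_mul_card H
    rw [← h2] at this
    exact Nat.eq_of_mul_eq_mul_right Nat.card_pos this
  have hZH : Subgroup.center G ≤ H := Subgroup.center_le_centralizer _
  have hZi : ((Subgroup.center G).subgroupOf H).index = 2 := by
    have h := Subgroup.index_mul_card ((Subgroup.center G).subgroupOf H)
    rw [Nat.card_congr (Subgroup.subgroupOfEquivOfLe hZH).toEquiv, ← hZ] at h
    exact Nat.eq_of_mul_eq_mul_right Nat.card_pos h
  have hmul : ∀ x ∈ H, ∀ y ∈ H, x ∉ Subgroup.center G → y ∉ Subgroup.center G →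
      x * y ∈ Subgroup.center G := fun x hx y hy hxZ hyZ => by
    have := (Subgroup.mul_mem_iff_of_index_two hZi (a := ⟨x, hx⟩) (b := ⟨y, hy⟩)).2
    simp only [Subgroup.mem_subgroupOf] at this
    exact this ⟨fun h => absurd h hxZ, fun h => absurd h hyZ⟩
  have haH : a ∈ H := Subgroup.mem_centralizer_singleton_iff.2 rfl
  refine ha (mem_center_of_centralizer_eq_top (eq_top_iff.2 fun y _ => ?_))
  have hnorm := Subgroup.normal_of_index_eq_two hHi
  -- The commutator `c` of `y` and `a` is central. Since `a * a` is central, `c * c = 1`; a center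
  -- of order 3 also gives `c ^ 3 = 1`, so `c = 1`.
  have hc : y * a * y⁻¹ * a⁻¹ ∈ Subgroup.center G := by
    refine hmul _ (hnorm.conj_mem a haH y) _ (inv_mem haH) (fun h => ha ?_)
      (fun h => ha (by simpa using h))
    have := (inferInstance : (Subgroup.center G).Normal).conj_mem _ h y⁻¹
    simpa [mul_assoc] using this
  have haa : a * a ∈ Subgroup.center G := hmul a haH a haH ha ha
  set c := y * a * y⁻¹ * a⁻¹ with hcdef
  have hca : y * a * y⁻¹ = c * a := by rw [hcdef]; group
  have hcc : c * c = 1 := by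
    have h1 : (c * a) * (c * a) = a * a := by
      rw [← hca]
      calc y * a * y⁻¹ * (y * a * y⁻¹) = y * (a * a) * y⁻¹ := by group
        _ = a * a := by rw [Subgroup.mem_center_iff.1 haa y, mul_inv_cancel_right]
    have h2 : (c * a) * (c * a) = (c * c) * (a * a) := by
      rw [mul_assoc, ← mul_assoc a c a, Subgroup.mem_center_iff.1 hc a]
      group
    rw [h2] at h1
    exact mul_eq_right.1 h1
  have hc3 : c ^ 3 = 1 := by
    have := pow_card_eq_one' (x := (⟨c, hc⟩ : Subgroup.center G))
    rw [h3] at this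
    exact congrArg Subtype.val this
  have hc1 : c = 1 := by rw [← hc3, pow_succ, pow_two, hcc, one_mul]
  rw [hc1, one_mul, mul_inv_eq_iff_eq_mul] at hca
  exact Subgroup.mem_centralizer_singleton_iff.2 hca

/-- The centralizer, of order at most `8`, of a non-central element is abelian if it has order
less than `8` or the center is nontrivial. -/
lemma mul_comm_of_mem_centralizer [Finite G] {a : G} (ha : a ∉ Subgroup.center G)
    (h8 : Nat.card (Subgroup.centralizer {a}) < 8 ∨
      Nat.card (Subgroup.centralizer {a}) = 8 ∧ 1 < Nat.card (Subgroup.center G)) :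
    ∀ x ∈ Subgroup.centralizer {a}, ∀ y ∈ Subgroup.centralizer {a}, x * y = y * x := by
  set H := Subgroup.centralizer {a} with hH
  have hZH : Subgroup.center G ≤ H := Subgroup.center_le_centralizer _
  have haH : a ∈ H := Subgroup.mem_centralizer_singleton_iff.2 rfl
  -- The center of `H` contains that of `G` and also `a`; the extra element brings its index in `H`
  -- below 4.
  have hlt : Nat.card (Subgroup.center G) < Nat.card (Subgroup.center H) := by
    have h1 : (Subgroup.center G).subgroupOf H < Subgroup.center H := by
      refine lt_of_le_of_ne (fun x hx => Subgroup.mem_center_iff.2 fun y =>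
        Subtype.ext (Subgroup.mem_center_iff.1 hx y)) fun h => ha ?_
      have : (⟨a, haH⟩ : H) ∈ Subgroup.center H := Subgroup.mem_center_iff.2 fun y =>
        Subtype.ext (Subgroup.mem_centralizer_singleton_iff.1 y.2)
      rw [← h] at this
      exact this
    rw [← Nat.card_congr (Subgroup.subgroupOfEquivOfLe hZH).toEquiv]
    exact Set.ncard_lt_ncard h1
  have hpos : 0 < Nat.card (Subgroup.center G) := Nat.card_pos
  have hidx := Subgroup.index_mul_card (Subgroup.center H)
  have h4 : (Subgroup.center H).index < 4 := by
    by_contra! h4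
    have := Nat.mul_le_mul_right (Nat.card (Subgroup.center H)) h4
    omega
  exact fun x hx y hy => congrArg Subtype.val (mul_comm_of_index_center_lt_four h4 ⟨x, hx⟩ ⟨y, hy⟩)

lemma one_lt_card_center [Finite G] {p k : ℕ} [Fact p.Prime] (h : Nat.card G = p ^ (k + 1)) :
    1 < Nat.card (Subgroup.center G) := by
  have hp : 1 < p := (Fact.out : p.Prime).one_lt
  have : Nontrivial G := Finite.one_lt_card_iff_nontrivial.1 (by
    rw [h]; exact Nat.one_lt_pow (Nat.succ_ne_zero k) hp)
  have := (IsPGroup.of_card h).center_nontrivial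
  exact Finite.one_lt_card_iff_nontrivial.2 this

/-- The centralizer has order `m` from 5 to 8 and the center has order a proper divisor `z` of `m`.
Only `m = 6`, `z = 3` violates `z + 4 ≤ m`, and `card_center_ne_three` excludes it. -/
lemma not_embedsIn_torus_of_two_mul_card_centralizer [Finite G] (hn : 10 ≤ Nat.card G)
    (hn' : Nat.card G ≤ 16) {a : G} (ha : a ∉ Subgroup.center G)
    (h2 : 2 * Nat.card (Subgroup.centralizer {a}) = Nat.card G) :
    ¬ EmbedsIn (nonCommutingGraph G) TorusSurface := by
  have hZH : Subgroup.center G ≤ Subgroup.centralizer {a} := Subgroup.center_le_centralizer _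
  have hab := mul_comm_of_mem_centralizer ha (by
    rcases hn'.lt_or_eq with h | h
    · left; omega
    · exact Or.inr ⟨by omega, one_lt_card_center (p := 2) (k := 3) h⟩)
  refine not_embedsIn_torus_of_abelian_index_two hab h2 hZH ?_ (by omega)
  have h3 := card_center_ne_three ha h2
  obtain ⟨d, hd⟩ := Subgroup.card_dvd_of_le hZH
  have hlt : Nat.card (Subgroup.center G) < Nat.card (Subgroup.centralizer {a}) := by
    refine Set.ncard_lt_ncard (lt_of_le_of_ne hZH fun h => ha ?_)
    rw [SetLike.coe_injective h]
    exact Subgroup.mem_centralizer_singleton_iff.2 rfl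
  have hpos : 0 < Nat.card (Subgroup.center G) := Nat.card_pos
  generalize Nat.card (Subgroup.center G) = z at *
  generalize Nat.card (Subgroup.centralizer {a}) = m at *
  have hm : m ≤ 8 := by omega
  have hm5 : 5 ≤ m := by omega
  have hd2 : 2 ≤ d := by
    by_contra! h
    interval_cases d <;> omega
  have hz : z ≤ 4 := by nlinarith
  interval_cases z <;> interval_cases m <;> omega

/-- The non-commuting graph of a non-abelian group of order at least `9` does not embed in the
torus. -/
theorem nonCommutingGraph_not_embedsIn_torus [Finite G] (hG : ∃ x y : G, x * y ≠ y * x)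
    (hn : 9 ≤ Nat.card G) : ¬ EmbedsIn (nonCommutingGraph G) TorusSurface := by
  have hn10 : 10 ≤ Nat.card G := by
    refine Nat.lt_of_le_of_ne hn fun h => ?_
    obtain ⟨x, y, hxy⟩ := hG
    have : Fact (Nat.Prime 3) := ⟨Nat.prime_three⟩
    have := IsPGroup.isMulCommutative_of_card_eq_prime_sq (p := 3) (G := G) (by rw [← h]; rfl)
    exact hxy (this.is_comm.comm x y)
  obtain ⟨a, a', b, b', h4, ha', hb', ha, hb⟩ := exists_pairs hG hn
  by_cases h17 : 17 ≤ Nat.card G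
  -- Indices at least 2 give a product of at least `n² / 4`, which exceeds `4n` from 17 on.
  · refine not_embedsIn_torus_of_pairs h4 ha' hb' ?_
    have h1 := two_mul_card_centralizer_le ha
    have h2 := two_mul_card_centralizer_le hb
    generalize Nat.card (Subgroup.centralizer {a}) = s at *
    generalize Nat.card (Subgroup.centralizer {b}) = t at *
    generalize Nat.card G = n at *
    have h3 : n ≤ 2 * (n - s) := by omega
    have h5 : n ≤ 2 * (n - t) := by omega
    nlinarith
  rcases card_centralizer_eq_or_le ha with h1 | h1
  · exact not_embedsIn_torus_of_two_mul_card_centralizer hn10 (by omega) ha h1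
  rcases card_centralizer_eq_or_le hb with h2 | h2
  · exact not_embedsIn_torus_of_two_mul_card_centralizer hn10 (by omega) hb h2
  -- Indices at least 3 give at least `4n² / 9`, which exceeds `4n` from 10 on.
  refine not_embedsIn_torus_of_pairs h4 ha' hb' ?_
  generalize Nat.card (Subgroup.centralizer {a}) = s at *
  generalize Nat.card (Subgroup.centralizer {b}) = t at *
  generalize Nat.card G = n at *
  have h3 : 2 * n ≤ 3 * (n - s) := by omega
  have h5 : 2 * n ≤ 3 * (n - t) := by omega
  nlinarith

/-! ### Planarity for the orders 6 and 8 -/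

/-- The non-commuting graph of a non-abelian group of order `8` is a subgraph of the octahedron. -/
lemma nonCommutingGraph_embedsIn_sphere_of_card_eq_eight [Finite G]
    (hG : ∃ x y : G, x * y ≠ y * x) (hn : Nat.card G = 8) :
    EmbedsIn (nonCommutingGraph G) SphereSurface := by
  have hZ : Nat.card (Subgroup.center G) = 2 := by
    have h1 := one_lt_card_center (G := G) (p := 2) (k := 2) hn
    have h2 := four_mul_card_center_le hG
    omega
  have hQ : Nat.card (G ⧸ Subgroup.center G) = 4 := by
    have := Subgroup.index_mul_card (Subgroup.center G)
    rw [hZ, hn] at this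
    exact Nat.eq_of_mul_eq_mul_right two_pos this
  have hQ1 : Nat.card {q : G ⧸ Subgroup.center G // q ≠ 1} = 3 := by
    have := Set.ncard_add_ncard_compl ({1} : Set (G ⧸ Subgroup.center G))
    rw [Set.ncard_singleton, hQ] at this
    exact Nat.add_left_cancel this
  -- The three non-trivial cosets of the center consist of two commuting elements each: these are
  -- the antipodal pairs.
  let e := Finite.equivFinOfCardEq hQ1
  let q : {g : G // g ∉ Subgroup.center G} → {q : G ⧸ Subgroup.center G // q ≠ 1} := fun x =>
    ⟨(x.1 : G), fun h => x.2 ((QuotientGroup.eq_one_iff _).1 h)⟩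
  let φ : {g : G // g ∉ Subgroup.center G} → Fin 3 × Bool := fun x =>
    (e (q x), by classical exact decide (x.1 = (x.1 : G ⧸ Subgroup.center G).out))
  have hq : ∀ x y, q x = q y → (x.1 : G ⧸ Subgroup.center G) = (y.1 : G ⧸ Subgroup.center G) :=
    fun x y h => congrArg Subtype.val h
  have hφ : Function.Injective φ := by
    intro x y h
    have h1 := hq x y (e.injective (congrArg Prod.fst h))
    have h2 := decide_eq_decide.1 (congrArg Prod.snd h)
    rw [← h1] at h2
    set r := (x.1 : G ⧸ Subgroup.center G).out with hr
    by_cases hx : x.1 = r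
    · exact Subtype.ext (hx.trans (h2.1 hx).symm)
    have hy : y.1 ≠ r := fun h => hx (h2.2 h)
    have hrx : r⁻¹ * x.1 ∈ Subgroup.center G :=
      QuotientGroup.eq.1 (by rw [hr, QuotientGroup.out_eq'])
    have hry : r⁻¹ * y.1 ∈ Subgroup.center G :=
      QuotientGroup.eq.1 (by rw [hr, QuotientGroup.out_eq', h1])
    obtain ⟨z, -, hz⟩ := (Nat.card_eq_two_iff' (1 : Subgroup.center G)).1 hZ
    have h3 := (hz ⟨_, hrx⟩ fun h => hx (inv_mul_eq_one.1 (congrArg Subtype.val h)).symm).trans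
      (hz ⟨_, hry⟩ fun h => hy (inv_mul_eq_one.1 (congrArg Subtype.val h)).symm).symm
    exact Subtype.ext (mul_left_cancel (congrArg Subtype.val h3))
  refine EmbedsIn.of_injective_hom (Δ := octahedron) ⟨φ, fun {x y} hxy h => hxy ?_⟩ hφ
    octahedron_embedsIn_sphere
  have h1 := QuotientGroup.eq.1 (hq x y (e.injective h))
  have h2 := Subgroup.mem_center_iff.1 h1 x.1
  rwa [mul_inv_cancel_left, mul_assoc, eq_inv_mul_iff_mul_eq] at h2

/-- The non-commuting graph of a non-abelian group of order `6` is a subgraph of the triangular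
bipyramid. -/
lemma nonCommutingGraph_embedsIn_sphere_of_card_eq_six [Finite G]
    (hG : ∃ x y : G, x * y ≠ y * x) (hn : Nat.card G = 6) :
    EmbedsIn (nonCommutingGraph G) SphereSurface := by
  have hZ : Nat.card (Subgroup.center G) = 1 := by
    have h1 := four_mul_card_center_le hG
    have h2 : 0 < Nat.card (Subgroup.center G) := Nat.card_pos
    omega
  have hV : Nat.card {g : G // g ∉ Subgroup.center G} = 5 := by
    have h := Set.ncard_add_ncard_compl (Subgroup.center G : Set G)
    rw [hn, show (Subgroup.center G : Set G).ncard = 1 from hZ] at h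
    exact Nat.add_left_cancel h
  let e := Finite.equivFinOfCardEq hV
  -- An element of order 3 commutes with its inverse; the two become the non-adjacent apexes 3 and
  -- 4.
  obtain ⟨x, hx⟩ := exists_prime_orderOf_dvd_card' (G := G) 3 (by rw [hn]; decide)
  have hxZ : x ∉ Subgroup.center G := fun h => by
    rw [Subgroup.eq_bot_of_card_eq _ hZ, Subgroup.mem_bot] at h
    simp [h] at hx
  have hxx : x ≠ x⁻¹ := fun h => by
    have h2 : x ^ 2 = 1 := by rw [pow_two]; exact mul_eq_one_iff_eq_inv.2 h
    have := orderOf_dvd_of_pow_eq_one h2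
    rw [hx] at this
    omega
  let u : {g : G // g ∉ Subgroup.center G} := ⟨x, hxZ⟩
  let v : {g : G // g ∉ Subgroup.center G} := ⟨x⁻¹, fun h => hxZ (by simpa using h)⟩
  have huv : u ≠ v := fun h => hxx (congrArg Subtype.val h)
  obtain ⟨σ, hσ⟩ : ∃ σ : Equiv.Perm (Fin 5), σ (e u) = 3 ∧ σ (e v) = 4 := by
    have := e.injective.ne huv
    generalize e u = i at *
    generalize e v = j at *
    refine ⟨Equiv.swap (Equiv.swap i 3 j) 4 * Equiv.swap i 3, ?_⟩
    revert i j
    decide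
  let f := e.trans σ
  have hf : ∀ w, 3 ≤ f w → w = u ∨ w = v := fun w hw => by
    have h : f w = 3 ∨ f w = 4 := by omega
    exact h.imp (fun h => f.injective (h.trans hσ.1.symm))
      fun h => f.injective (h.trans hσ.2.symm)
  refine EmbedsIn.of_injective_hom (Δ := bipyramid)
    ⟨f, fun {y z} hyz => ⟨f.injective.ne hyz.ne, ?_⟩⟩ f.injective bipyramid_embedsIn_sphere
  by_contra! h
  refine hyz ?_
  rcases hf y h.1 with rfl | rfl <;> rcases hf z h.2 with rfl | rfl <;> simp [u, v]

/-- A non-abelian group of order less than `9` has order `6` or `8`. -/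
lemma card_eq_six_or_eight [Finite G] (hG : ∃ x y : G, x * y ≠ y * x) (hn : Nat.card G < 9) :
    Nat.card G = 6 ∨ Nat.card G = 8 := by
  obtain ⟨x, y, hxy⟩ := id hG
  have hprime : ∀ p : ℕ, p.Prime → Nat.card G ≠ p := fun p hp h => by
    have := Fact.mk hp
    have := isCyclic_of_prime_card h
    exact hxy (IsCyclic.isMulCommutative.is_comm.comm x y)
  have h4 : Nat.card G ≠ 4 := fun h => by
    have : Fact (Nat.Prime 2) := ⟨Nat.prime_two⟩
    exact hxy ((IsPGroup.isMulCommutative_of_card_eq_prime_sq (p := 2) h).is_comm.comm x y)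
  have h := four_mul_card_center_le hG
  have hpos : 0 < Nat.card (Subgroup.center G) := Nat.card_pos
  have h5 := hprime 5 Nat.prime_five
  have h7 := hprime 7 (by norm_num)
  omega

end

theorem mainTheorem3 (G : Type*) [Group G] [Finite G] (hG : ∃ x y : G, x * y ≠ y * x) :
    ¬ IsToroidal (nonCommutingGraph G) := by
  rintro ⟨htorus, hsphere⟩
  rcases le_or_gt 9 (Nat.card G) with hn | hn
  · exact nonCommutingGraph_not_embedsIn_torus hG hn htorus
  · rcases card_eq_six_or_eight hG hn with h | h
    · exact hsphere (nonCommutingGraph_embedsIn_sphere_of_card_eq_six hG h)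
    · exact hsphere (nonCommutingGraph_embedsIn_sphere_of_card_eq_eight hG h)
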